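/- All systems are finite-dimensional, entropies are in nats, $H(\cdot)$ is the von Neumann entropy, $H(P|Q)=H(PQ)-H(Q)$ and $I(P{:}P'|Q)=H(P|Q)-H(P|P'Q)$. **The engine.** Let $k_B,T_h,T_c,T_m>0$. The systems are a reference $R$ (zero Hamiltonian), a system $S$, an ancilla $A$ with energy eigenbasis $|\varepsilon_x\rangle$, a hot bath $B_h$, a cold bath $B_c$, a measurement apparatus $M$ and classical registers $X,Y$; write $E=RSAB_hB_c$. The initial state is $|\psi\rangle\langle\psi|^{RS}\otimes\tau_c^A\otimes\tau_h^{B_h}\otimes\tau_c^{B_c}\otimes|0\rangle\langle0|^X\otimes|0\rangle\langle0|^Y$, where $\psi^{RS}$ is any pure state, the $\tau$'s are thermal states ($A$ and $B_c$ at temperature $T_c$, $B_h$ at $T_h$), and $|0\rangle^Y$ is a ground state of the Hamiltonian $\mathscr H^Y$. The states $\sigma_i\to\sigma_0\to\sigma_{\rm enc}\to\sigma_1\to\sigma_2\to\sigma_3\to\sigma_f$ arise as follows. * $\sigma_0$: $A$ is measured in its energy basis and the outcome $x$, of probability $p_X(x)=e^{-\varepsilon_x/k_BT_c}/\sum_{x'}e^{-\varepsilon_{x'}/k_BT_c}$,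 is recorded in $X$. * $\sigma_{\rm enc}$: a unitary $U_{{\rm enc},x}$ acts on $SA$. * $\sigma_1$: a unitary $U_h$ on $SAB_h$ that commutes with the total Hamiltonian acts. * $\sigma_2$: a quantum instrument $\{\mathcal N_{y|x}\}_y$ on $SA$ acts and $y$ is recorded in $Y$. It is realized by a unitary on $SAMY$, with $M$ initially in the thermal state of temperature $T_m$ and $Y$ in $|0\rangle$, in the sense that the reduced output on $SAY$ is $\mathcal N_{|x}(\cdot)=\sum_y\mathcal N_{y|x}(\cdot)\otimes|y\rangle\langle y|^Y$. * $\sigma_3$: a unitary $U_{{\rm dec},xy}$ acts on $SA$. * $\sigma_f$: a unitary on $AB_c$ acts which commutes with the total Hamiltonian and returns $A$ to $\tau_c^A$ from every input (for example a swap with a copy of $A$ in $B_c$). Finally $X,Y$ are erased to $|0\rangle$. The Hamiltonian of $SA$ is $\mathscr H^S+\mathscr H^A$ up to $\sigma_0$ and from $\sigma_3$ on, and a Hermitian $\mathscr H^{SA}_{\rm enc}$ at $\sigma_{\rm enc},\sigma_1,\sigma_2$. Let $\mathscr U$ be the internal energy of $RSAY$, and $\Delta\mathscr U$ its change over the cycle,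 erasure included. **Heat and work.** $Q_h$, $Q_c$ and $Q_{\rm meas}$ are the energies lost by $B_h$, $B_c$ and $M$ (the last one during the measurement), $Q^Y_{\rm erase}=\langle\mathscr H^Y\rangle_i-\langle\mathscr H^Y\rangle_f$, and $$Q^Y_{\rm meas}=k_BT_m\bigl(\Delta H(Y|X)-I(Y{:}M|X)_{\sigma_2}\bigr),\qquad Q^{RSA|Y}_{\rm meas}=k_BT_m\bigl(\Delta H(RSA|XY)-I(RSA{:}M|XY)_{\sigma_2}\bigr),$$ where $\Delta$ denotes the change in the measurement step. Further $W_{\rm tot}=W_{\rm enc}+W_{\rm meas}+W_{\rm dec}$ with $W_{\rm enc}=\mathscr U_{\rm enc}-\mathscr U_0$, $W_{\rm meas}=\mathscr U_2-\mathscr U_1-Q_{\rm meas}$ and $W_{\rm dec}=\mathscr U_3-\mathscr U_2$; $Q_{\rm input}=Q_h+Q^Y_{\rm meas}$; $\eta=-W_{\rm tot}/Q_{\rm input}$; $\eta_C=1-T_c/T_h$. The entropy exchange is $S_e=H(RS)_{\sigma_f}$. The efficacy is $\mathscr E(\mathcal N;\rho)=\mathrm{Tr}[\mathcal N^\dagger\circ\mathcal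 N(\rho)]$, where $\mathcal N_{|x}$ acts as the identity on $RB_hB_c$, and $\sigma^E_{1,x}$ is the state of $E$ at stage $1$ given $x$. **Theorem.** Suppose $Q_{\rm input}>0$ and $Q^{RSA|Y}_{\rm meas}\le0$, and let $\varepsilon_1,\varepsilon_2,\varepsilon_3\ge0$ be such that 1. (high fidelity) $|\Delta\mathscr U|\le\varepsilon_1Q_{\rm input}$; 2. (negligible entropy of $X$) $H(X|E)_{\sigma_f}\le\varepsilon_2\,H(Y|EX)_{\sigma_f}$; 3. (Landauer bound reached) $\bigl||Q^Y_{\rm erase}|-k_BT_cH(Y|X)_{\sigma_2}\bigr|\le\varepsilon_3\,k_BT_cH(Y|X)_{\sigma_2}$; 4. (measurement heat) $|Q^{RSA|Y}_{\rm meas}|\ge\frac{T_c}{T_h}Q^Y_{\rm meas}$. Then $$S_e\ \ge\ \frac{Q_{\rm input}}{k_BT_h}\,\frac{\eta-\eta_C}{1-\eta_C}+\sum_xp_X(x)\bigl[-\ln\mathscr E(\mathcal N_{|x};\sigma^E_{1,x})\bigr]-\varepsilon_1\frac{Q_{\rm input}}{k_BT_c}-(\varepsilon_2+\varepsilon_3)H(Y|X)_{\sigma_2}.$$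 In particular, when assumptions 1–3 hold exactly ($\varepsilon_1=\varepsilon_2=\varepsilon_3=0$), $$S_e\ \ge\ \frac{Q_{\rm input}}{k_BT_h}\,\frac{\eta-\eta_C}{1-\eta_C}+\sum_xp_X(x)\bigl[-\ln\mathscr E(\mathcal N_{|x};\sigma^E_{1,x})\bigr].$$ -/

import Mathlib

open scoped Kronecker Matrix ComplexOrder

namespace QECEngine

noncomputable section

/-! ### Finite-dimensional quantum mechanics

A system with Hilbert space of finite dimension is given by a finite index type `ι` (an orthonormal
basis); its operators are the complex `ι × ι` matrices and composite systems have product index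
types. -/

section Quantum

variable {ι κ μ ν : Type*} [Fintype ι] [DecidableEq ι] [Fintype κ] [DecidableEq κ]
  [Fintype μ] [DecidableEq μ] [Fintype ν] [DecidableEq ν]

/-- Partial trace over the second factor. -/
def traceRight (ρ : Matrix (ι × κ) (ι × κ) ℂ) : Matrix ι ι ℂ :=
  Matrix.of fun i j => ∑ k, ρ (i, k) (j, k)

/-- Partial trace over the first factor. -/
def traceLeft (ρ : Matrix (ι × κ) (ι × κ) ℂ) : Matrix κ κ ℂ :=
  Matrix.of fun i j => ∑ k, ρ (k, i) (k, j)

/-- Reduced state on the subsystem `κ` of `ι ≃ κ × ν`. -/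
def marginal (e : ι ≃ κ × ν) (ρ : Matrix ι ι ℂ) : Matrix κ κ ℂ :=
  traceRight (ρ.submatrix e.symm e.symm)

/-- The operator `U ⊗ 1` on `ι ≃ κ × ν`, for an operator `U` on `κ`. -/
def lift (e : ι ≃ κ × ν) (U : Matrix κ κ ℂ) : Matrix ι ι ℂ :=
  (U ⊗ₖ (1 : Matrix ν ν ℂ)).submatrix e e

/-- Evolution `ρ ↦ (U ⊗ 1) ρ (U ⊗ 1)ᴴ` under a unitary of the subsystem `κ` of `ι ≃ κ × ν`. -/
def evolve (e : ι ≃ κ × ν) (U : Matrix.unitaryGroup κ ℂ) (ρ : Matrix ι ι ℂ) : Matrix ι ι ℂ :=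
  lift e (U : Matrix κ κ ℂ) * ρ * (lift e (U : Matrix κ κ ℂ))ᴴ

/-- The projector `|i⟩⟨i|` on a basis vector. -/
def basisProj (i : ι) : Matrix ι ι ℂ := Matrix.single i i 1

/-- The projector `|ψ⟩⟨ψ|` (for a unit vector `ψ`). -/
def pureState (ψ : ι → ℂ) : Matrix ι ι ℂ := Matrix.vecMulVec ψ (star ψ)

/-- Expectation value `Tr[ρ H]`. -/
def expect (ρ H : Matrix ι ι ℂ) : ℝ := (ρ * H).trace.re

/-- The thermal state `exp(-β H) / Tr exp(-β H)`. -/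
def gibbs (β : ℝ) (H : Matrix ι ι ℂ) : Matrix ι ι ℂ :=
  (cfc (fun t : ℝ => Real.exp (-β * t)) H).trace⁻¹ • cfc (fun t : ℝ => Real.exp (-β * t)) H

/-- The von Neumann entropy `-Tr[ρ ln ρ]` (in nats, with `0 ln 0 = 0`). -/
def entropy (ρ : Matrix ι ι ℂ) : ℝ := -(ρ * cfc Real.log ρ).trace.re

/-- Conditional entropy `H(ι|κ) = H(ικ) - H(κ)`. -/
def condEntropy (ρ : Matrix (ι × κ) (ι × κ) ℂ) : ℝ := entropy ρ - entropy (traceLeft ρ)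

/-- Conditional mutual information `I(ι:κ|μ) = H(ι|μ) - H(ι|κμ)` of a tripartite state. -/
def condMutualInfo (ρ : Matrix ((ι × κ) × μ) ((ι × κ) × μ) ℂ) : ℝ :=
  condEntropy (traceRight (ρ.submatrix
    (fun q : (ι × μ) × κ => ((q.1.1, q.2), q.1.2)) (fun q : (ι × μ) × κ => ((q.1.1, q.2), q.1.2))))
  - condEntropy (ρ.submatrix
    (fun q : ι × (κ × μ) => ((q.1, q.2.1), q.2.2)) (fun q : ι × (κ × μ) => ((q.1, q.2.1), q.2.2)))

/-- `N ⊗ id` for a linear map `N` from operators on `κ` to operators on `μ`. -/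
def tensorId (N : Matrix κ κ ℂ →ₗ[ℂ] Matrix μ μ ℂ) (ν : Type*) [Fintype ν] [DecidableEq ν] :
    Matrix (κ × ν) (κ × ν) ℂ →ₗ[ℂ] Matrix (μ × ν) (μ × ν) ℂ where
  toFun ρ := Matrix.of fun p q =>
    N (Matrix.of fun k k' => ρ (k, p.2) (k', q.2)) p.1 q.1
  map_add' ρ σ := by
    ext p q
    have h : (Matrix.of fun k k' => (ρ + σ) (k, p.2) (k', q.2))
        = (Matrix.of fun k k' => ρ (k, p.2) (k', q.2))
          + (Matrix.of fun k k' => σ (k, p.2) (k', q.2)) := rfl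
    simp only [Matrix.of_apply, Matrix.add_apply]
    exact (congrArg (fun M => N M p.1 q.1) h).trans (by rw [map_add]; rfl)
  map_smul' c ρ := by
    ext p q
    have h : (Matrix.of fun k k' => (c • ρ) (k, p.2) (k', q.2))
        = c • (Matrix.of fun k k' => ρ (k, p.2) (k', q.2)) := rfl
    simp only [Matrix.of_apply, Matrix.smul_apply, RingHom.id_apply]
    exact (congrArg (fun M => N M p.1 q.1) h).trans (by rw [map_smul]; rfl)

/-- The adjoint map `N†`, determined by `Tr[M N(L)] = Tr[N†(M) L]`. -/
def adjointMap (N : Matrix κ κ ℂ →ₗ[ℂ] Matrix μ μ ℂ) :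
    Matrix μ μ ℂ →ₗ[ℂ] Matrix κ κ ℂ where
  toFun M := Matrix.of fun i j => (M * N (Matrix.single j i 1)).trace
  map_add' M M' := by ext i j; simp [add_mul]
  map_smul' c M := by ext i j; simp

theorem trace_adjointMap (N : Matrix κ κ ℂ →ₗ[ℂ] Matrix μ μ ℂ) (M : Matrix μ μ ℂ)
    (L : Matrix κ κ ℂ) : (M * N L).trace = (adjointMap N M * L).trace := by
  conv_lhs => rw [Matrix.matrix_eq_sum_single L]
  have hs : ∀ i j, Matrix.single i j (L i j) = L i j • Matrix.single i j (1 : ℂ) := by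
    intro i j; simp
  simp only [hs, map_sum, map_smul, Finset.mul_sum, Matrix.mul_smul, Matrix.trace_sum,
    Matrix.trace_smul]
  rw [Finset.sum_comm]
  simp only [Matrix.trace, Matrix.diag, Matrix.mul_apply (M := adjointMap N M)]
  refine Finset.sum_congr rfl fun j _ => Finset.sum_congr rfl fun i _ => ?_
  simp [adjointMap, Matrix.trace, Matrix.diag, mul_comm]

/-- The efficacy `Tr[N†(N(ρ))]` of `N` with respect to `ρ`. -/
def efficacy (N : Matrix κ κ ℂ →ₗ[ℂ] Matrix μ μ ℂ) (ρ : Matrix κ κ ℂ) : ℝ :=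
  (adjointMap N (N ρ)).trace.re

/-- Complete positivity: `N ⊗ id` is positive for every ancilla. -/
def IsCompletelyPositive (N : Matrix κ κ ℂ →ₗ[ℂ] Matrix μ μ ℂ) : Prop :=
  ∀ (n : ℕ) (ρ : Matrix (κ × Fin n) (κ × Fin n) ℂ),
    ρ.PosSemidef → (tensorId N (Fin n) ρ).PosSemidef

/-- A quantum instrument with outcomes in `ν`: completely positive trace-non-increasing maps whose
sum is trace preserving. -/
structure IsInstrument (N : ν → Matrix κ κ ℂ →ₗ[ℂ] Matrix κ κ ℂ) : Prop where
  completelyPositive : ∀ y, IsCompletelyPositive (N y)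
  trace_le : ∀ y (ρ : Matrix κ κ ℂ), ρ.PosSemidef → (N y ρ).trace ≤ ρ.trace
  trace_eq : ∀ ρ : Matrix κ κ ℂ, (∑ y, N y ρ).trace = ρ.trace

/-- The joint action `ρ ↦ ∑ y, N y ρ ⊗ |y⟩⟨y|` of an instrument on the system and the memory. -/
def instrumentMap (N : ν → Matrix κ κ ℂ →ₗ[ℂ] Matrix κ κ ℂ) :
    Matrix κ κ ℂ →ₗ[ℂ] Matrix (κ × ν) (κ × ν) ℂ where
  toFun ρ := ∑ y, N y ρ ⊗ₖ basisProj y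
  map_add' ρ σ := by simp [Matrix.add_kronecker, Finset.sum_add_distrib]
  map_smul' c ρ := by simp [Matrix.smul_kronecker, Finset.smul_sum]

end Quantum

/-! ### The engine -/

/-- The error-correcting engine. Its systems are the reference `R`, the system `S`, the ancilla `A`,
the hot bath `B_h`, the cold bath `B_c`, the measurement apparatus `M` and the classical registers
`X` and `Y`, with index types `r s a bh bc m`, `a` and `y`. The basis of `A` is its energy basis and
the register `X` records which element of it was found. The register `Y` contains every possible
syndrome; outcomes that cannot occur for a given `x` have `N x y = 0`. -/
structure Engine (r s a bh bc m y : Type*)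
    [Fintype r] [DecidableEq r] [Fintype s] [DecidableEq s] [Fintype a] [DecidableEq a]
    [Fintype bh] [DecidableEq bh] [Fintype bc] [DecidableEq bc] [Fintype m] [DecidableEq m]
    [Fintype y] [DecidableEq y] where
  /-- the Boltzmann constant -/
  kB : ℝ
  /-- temperature of the hot bath -/
  Th : ℝ
  /-- temperature of the cold bath -/
  Tc : ℝ
  /-- temperature of the measurement apparatus -/
  Tm : ℝ
  kB_pos : 0 < kB
  Th_pos : 0 < Th
  Tc_pos : 0 < Tc
  Tm_pos : 0 < Tm
  /-- the energy levels of the ancilla -/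
  energyA : a → ℝ
  /-- Hamiltonian of `S` at the beginning and at the end of the cycle -/
  HS : Matrix s s ℂ
  /-- Hamiltonian of the encoded system `SA`, between encoding and error correction -/
  Henc : Matrix (s × a) (s × a) ℂ
  /-- Hamiltonian of the hot bath -/
  Hh : Matrix bh bh ℂ
  /-- Hamiltonian of the cold bath -/
  Hc : Matrix bc bc ℂ
  /-- Hamiltonian of the measurement apparatus -/
  HM : Matrix m m ℂ
  /-- Hamiltonian of the register `Y` -/
  HY : Matrix y y ℂ
  HS_herm : HS.IsHermitian
  Henc_herm : Henc.IsHermitian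
  Hh_herm : Hh.IsHermitian
  Hc_herm : Hc.IsHermitian
  HM_herm : HM.IsHermitian
  HY_herm : HY.IsHermitian
  /-- initial pointer state of `X` -/
  x0 : a
  /-- initial pointer state of `Y` -/
  y0 : y
  /-- the initial state of `Y` is a ground state -/
  ground : (HY - (HY y0 y0) • (1 : Matrix y y ℂ)).PosSemidef
  /-- the initial pure state of `RS` -/
  ψ : r × s → ℂ
  ψ_unit : ∑ i, ‖ψ i‖ ^ 2 = 1
  /-- encoding unitaries -/
  Uenc : a → Matrix.unitaryGroup (s × a) ℂ
  /-- the interaction of `SA` with the hot bath -/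
  Uh : Matrix.unitaryGroup ((s × a) × bh) ℂ
  /-- the noise is a thermal operation: `Uh` conserves the total energy -/
  Uh_comm : Commute (Uh : Matrix ((s × a) × bh) ((s × a) × bh) ℂ)
    (Henc ⊗ₖ (1 : Matrix bh bh ℂ) + (1 : Matrix (s × a) (s × a) ℂ) ⊗ₖ Hh)
  /-- the syndrome instruments, one for each `x` -/
  N : a → y → Matrix (s × a) (s × a) ℂ →ₗ[ℂ] Matrix (s × a) (s × a) ℂ
  N_instrument : ∀ x, IsInstrument (N x)
  /-- the unitary interaction of `SA`, the apparatus and the register `Y` which realizes the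
  instrument (for instance `V^{MY} U^{SAM}` with a syndrome-controlled shift `V^{MY}`) -/
  Umeas : a → Matrix.unitaryGroup (((s × a) × m) × y) ℂ
  /-- with a thermal apparatus and `Y` in its initial state, `Umeas x` realizes the instrument -/
  Umeas_realizes : ∀ x (ρ : Matrix (s × a) (s × a) ℂ),
    marginal (⟨fun q => ((q.1.1, q.2), q.1.2), fun q => ((q.1.1, q.2), q.1.2),
        fun _ => rfl, fun _ => rfl⟩ : ((s × a) × m) × y ≃ ((s × a) × y) × m)
      ((Umeas x : Matrix (((s × a) × m) × y) (((s × a) × m) × y) ℂ)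
        * ((ρ ⊗ₖ gibbs (1 / (kB * Tm)) HM) ⊗ₖ basisProj y0)
        * (Umeas x : Matrix (((s × a) × m) × y) (((s × a) × m) × y) ℂ)ᴴ)
      = instrumentMap (N x) ρ
  /-- decoding unitaries -/
  Udec : a → y → Matrix.unitaryGroup (s × a) ℂ
  /-- the interaction of the ancilla with the cold bath -/
  Uc : Matrix.unitaryGroup (a × bc) ℂ
  /-- the reset is a thermal operation: `Uc` conserves the total energy -/
  Uc_comm : Commute (Uc : Matrix (a × bc) (a × bc) ℂ)
    (Matrix.diagonal (fun i => (energyA i : ℂ)) ⊗ₖ (1 : Matrix bc bc ℂ)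
      + (1 : Matrix a a ℂ) ⊗ₖ Hc)
  /-- the reset is fully thermalizing: every input is replaced by the thermal state of the ancilla
  (for instance a swap with a copy of the ancilla contained in the cold bath) -/
  Uc_reset : ∀ ρ : Matrix a a ℂ,
    traceRight ((Uc : Matrix (a × bc) (a × bc) ℂ) * (ρ ⊗ₖ gibbs (1 / (kB * Tc)) Hc)
        * (Uc : Matrix (a × bc) (a × bc) ℂ)ᴴ)
      = ρ.trace • gibbs (1 / (kB * Tc)) (Matrix.diagonal fun i => (energyA i : ℂ))

namespace Engine

variable {r s a bh bc m y : Type*}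
  [Fintype r] [DecidableEq r] [Fintype s] [DecidableEq s] [Fintype a] [DecidableEq a]
  [Fintype bh] [DecidableEq bh] [Fintype bc] [DecidableEq bc] [Fintype m] [DecidableEq m]
  [Fintype y] [DecidableEq y]

/-- The systems `R S A B_h B_c`. -/
abbrev Sys (r s a bh bc : Type*) : Type _ := (((r × s) × a) × bh) × bc

/-- `SA` inside `RSAB_hB_c`. -/
def splitSA : Sys r s a bh bc ≃ (s × a) × ((r × bh) × bc) :=
  ⟨fun q => ((q.1.1.1.2, q.1.1.2), ((q.1.1.1.1, q.1.2), q.2)),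
   fun q => ((((q.2.1.1, q.1.1), q.1.2), q.2.1.2), q.2.2), fun _ => rfl, fun _ => rfl⟩

/-- `SAB_h` inside `RSAB_hB_c`. -/
def splitSAh : Sys r s a bh bc ≃ ((s × a) × bh) × (r × bc) :=
  ⟨fun q => (((q.1.1.1.2, q.1.1.2), q.1.2), (q.1.1.1.1, q.2)),
   fun q => ((((q.2.1, q.1.1.1), q.1.1.2), q.1.2), q.2.2), fun _ => rfl, fun _ => rfl⟩

/-- `AB_c` inside `RSAB_hB_c`. -/
def splitAc : Sys r s a bh bc ≃ (a × bc) × ((r × s) × bh) :=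
  ⟨fun q => ((q.1.1.2, q.2), (q.1.1.1, q.1.2)),
   fun q => (((q.2.1, q.1.1), q.2.2), q.1.2), fun _ => rfl, fun _ => rfl⟩

/-- `SAMY` inside `RSAMY`. -/
def splitSAMY : (((r × s) × a) × m) × y ≃ (((s × a) × m) × y) × r :=
  ⟨fun q => ((((q.1.1.1.2, q.1.1.2), q.1.2), q.2), q.1.1.1.1),
   fun q => ((((q.2, q.1.1.1.1), q.1.1.1.2), q.1.1.2), q.1.2), fun _ => rfl, fun _ => rfl⟩

/-- `XY` inside `EXY`. -/
def splitXY {E : Type*} : (E × a) × y ≃ (y × a) × E :=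
  ⟨fun q => ((q.2, q.1.2), q.1.1), fun q => ((q.2, q.1.2), q.1.1), fun _ => rfl, fun _ => rfl⟩

/-- `YEX` from `EXY`. -/
def splitYEX {E : Type*} : y × (E × a) → (E × a) × y := fun q => (q.2, q.1)

/-- `XE` from `EX`. -/
def splitXE {E : Type*} : a × E → E × a := fun q => (q.2, q.1)

/-- `YX` inside `RSAMYX`. -/
def splitYX {Q : Type*} : ((Q × m) × y) × a ≃ (y × a) × (Q × m) :=
  ⟨fun q => ((q.1.2, q.2), q.1.1), fun q => ((q.2, q.1.1), q.1.2), fun _ => rfl, fun _ => rfl⟩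

/-- `YMX` inside `RSAMYX`. -/
def splitYMX {Q : Type*} : ((Q × m) × y) × a ≃ ((y × m) × a) × Q :=
  ⟨fun q => (((q.1.2, q.1.1.2), q.2), q.1.1.1), fun q => (((q.2, q.1.1.2), q.1.1.1), q.1.2),
   fun _ => rfl, fun _ => rfl⟩

/-- `RSA` with `YX` inside `RSAMYX`. -/
def splitQYX {Q : Type*} : ((Q × m) × y) × a ≃ (Q × (y × a)) × m :=
  ⟨fun q => ((q.1.1.1, (q.1.2, q.2)), q.1.1.2), fun q => (((q.1.1, q.2), q.1.2.1), q.1.2.2),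
   fun _ => rfl, fun _ => rfl⟩

/-- `RSA`, `M` and `YX` from `RSAMYX`. -/
def splitQMYX {Q : Type*} : (Q × m) × (y × a) → ((Q × m) × y) × a :=
  fun q => ((q.1, q.2.1), q.2.2)

variable (G : Engine r s a bh bc m y)

/-- Hamiltonian of the ancilla. -/
def HA : Matrix a a ℂ := Matrix.diagonal fun i => (G.energyA i : ℂ)

/-- Hamiltonian of `SA` at the beginning and at the end of the cycle. -/
def Hinit : Matrix (s × a) (s × a) ℂ :=
  G.HS ⊗ₖ (1 : Matrix a a ℂ) + (1 : Matrix s s ℂ) ⊗ₖ G.HA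

/-- Thermal state of the ancilla. -/
def τA : Matrix a a ℂ := gibbs (1 / (G.kB * G.Tc)) G.HA

/-- Thermal state of the hot bath. -/
def τh : Matrix bh bh ℂ := gibbs (1 / (G.kB * G.Th)) G.Hh

/-- Thermal state of the cold bath. -/
def τc : Matrix bc bc ℂ := gibbs (1 / (G.kB * G.Tc)) G.Hc

/-- Thermal state of the measurement apparatus. -/
def τM : Matrix m m ℂ := gibbs (1 / (G.kB * G.Tm)) G.HM

/-- The Gibbs distribution `p_X` of the initial measurement of the ancilla. -/
def pX (x : a) : ℝ :=
  Real.exp (-(1 / (G.kB * G.Tc)) * G.energyA x)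
    / ∑ x', Real.exp (-(1 / (G.kB * G.Tc)) * G.energyA x')

/-! ### States of `E = RSAB_hB_c`, given the value `x` of `X` -/

/-- After the initial measurement. -/
def σ0 (x : a) : Matrix (Sys r s a bh bc) (Sys r s a bh bc) ℂ :=
  ((pureState G.ψ ⊗ₖ basisProj x) ⊗ₖ G.τh) ⊗ₖ G.τc

/-- After the encoding. -/
def σenc (x : a) : Matrix (Sys r s a bh bc) (Sys r s a bh bc) ℂ :=
  evolve splitSA (G.Uenc x) (G.σ0 x)

/-- After the thermal noise. -/
def σ1 (x : a) : Matrix (Sys r s a bh bc) (Sys r s a bh bc) ℂ :=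
  evolve splitSAh G.Uh (G.σenc x)

/-- After the syndrome `y`, weighted with its probability: `p(y|x) σ_{2,xy}`. -/
def σ2 (x : a) (k : y) : Matrix (Sys r s a bh bc) (Sys r s a bh bc) ℂ :=
  (tensorId (G.N x k) ((r × bh) × bc)
    ((G.σ1 x).submatrix splitSA.symm splitSA.symm)).submatrix splitSA splitSA

/-- After the error correction: `p(y|x) σ_{3,xy}`. -/
def σ3 (x : a) (k : y) : Matrix (Sys r s a bh bc) (Sys r s a bh bc) ℂ :=
  evolve splitSA (G.Udec x k) (G.σ2 x k)

/-- After the reset of the ancilla: `p(y|x) σ_{f,xy}`. -/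
def σf (x : a) (k : y) : Matrix (Sys r s a bh bc) (Sys r s a bh bc) ℂ :=
  evolve splitAc G.Uc (G.σ3 x k)

/-! ### States of the whole engine `EXY` -/

/-- Operators on `EXY`. -/
abbrev Op (r s a bh bc y : Type*) : Type _ :=
  Matrix ((Sys r s a bh bc × a) × y) ((Sys r s a bh bc × a) × y) ℂ

/-- The state `∑ p_X(x) ρ_{xy} ⊗ |x,y⟩⟨x,y|`, with `ρ_{xy}` weighted by `p(y|x)`. -/
def cqState (ρ : a → y → Matrix (Sys r s a bh bc) (Sys r s a bh bc) ℂ) : Op r s a bh bc y :=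
  ∑ x, ∑ k, (G.pX x : ℂ) • ((ρ x k ⊗ₖ basisProj x) ⊗ₖ basisProj k)

/-- The state `∑ p_X(x) ρ_x ⊗ |x⟩⟨x| ⊗ |0⟩⟨0|`, before the syndrome is recorded. -/
def cqState₀ (ρ : a → Matrix (Sys r s a bh bc) (Sys r s a bh bc) ℂ) : Op r s a bh bc y :=
  ∑ x, (G.pX x : ℂ) • ((ρ x ⊗ₖ basisProj x) ⊗ₖ basisProj G.y0)

/-- Initial state. -/
def stateI : Op r s a bh bc y :=
  (((((pureState G.ψ ⊗ₖ G.τA) ⊗ₖ G.τh) ⊗ₖ G.τc) ⊗ₖ basisProj G.x0) ⊗ₖ basisProj G.y0)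

/-- After the initial measurement. -/
def state0 : Op r s a bh bc y := G.cqState₀ G.σ0

/-- After the encoding. -/
def stateEnc : Op r s a bh bc y := G.cqState₀ G.σenc

/-- After the thermal noise. -/
def state1 : Op r s a bh bc y := G.cqState₀ G.σ1

/-- After the syndrome measurement. -/
def state2 : Op r s a bh bc y := G.cqState G.σ2

/-- After the error correction. -/
def state3 : Op r s a bh bc y := G.cqState G.σ3

/-- After the reset of the ancilla. -/
def stateF : Op r s a bh bc y := G.cqState G.σf

/-- Reduced state of `E`. -/
def redE (ρ : Op r s a bh bc y) : Matrix (Sys r s a bh bc) (Sys r s a bh bc) ℂ :=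
  traceRight (traceRight ρ)

/-- Reduced state of `RSA`. -/
def redRSA (ρ : Matrix (Sys r s a bh bc) (Sys r s a bh bc) ℂ) :
    Matrix ((r × s) × a) ((r × s) × a) ℂ :=
  traceRight (traceRight ρ)

/-- Reduced state of `RS`. -/
def redRS (ρ : Op r s a bh bc y) : Matrix (r × s) (r × s) ℂ := traceRight (redRSA (redE ρ))

/-- Reduced state of `SA`. -/
def redSA (ρ : Op r s a bh bc y) : Matrix (s × a) (s × a) ℂ := marginal splitSA (redE ρ)

/-- Reduced state of the hot bath. -/
def redBh (ρ : Op r s a bh bc y) : Matrix bh bh ℂ := traceLeft (traceRight (redE ρ))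

/-- Reduced state of the cold bath. -/
def redBc (ρ : Op r s a bh bc y) : Matrix bc bc ℂ := traceLeft (redE ρ)

/-- Reduced state of the register `Y`. -/
def redY (ρ : Op r s a bh bc y) : Matrix y y ℂ := traceLeft ρ

/-- After the erasure of the registers, which are returned to their initial states. -/
def stateErase : Op r s a bh bc y :=
  (redE G.stateF ⊗ₖ basisProj G.x0) ⊗ₖ basisProj G.y0

/-! ### Information-theoretic quantities -/

/-- The entropy exchange `S_e`, the final entropy of `RS`. -/
def entropyExchange : ℝ := entropy (redRS G.stateF)

/-- `H(Y|X)` after the syndrome measurement. -/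
def entropyYgivenX : ℝ := condEntropy (marginal splitXY G.state2)

/-- `H(X|E)` in the final state. -/
def entropyXgivenE : ℝ := condEntropy ((traceRight G.stateF).submatrix splitXE splitXE)

/-- `H(Y|EX)` in the final state. -/
def entropyYgivenEX : ℝ := condEntropy (G.stateF.submatrix splitYEX splitYEX)

/-- The efficacy of the syndrome instrument `N_{|x}` (acting on `SA`, with the memory `Y` as part of
the output) with respect to the state of `E` before the measurement. -/
def instrumentEfficacy (x : a) : ℝ :=
  efficacy (tensorId (instrumentMap (G.N x)) ((r × bh) × bc))
    ((G.σ1 x).submatrix splitSA.symm splitSA.symm)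

/-! ### The syndrome measurement with its apparatus, on `RSAMYX` -/

/-- State of `RSAMY` before the measurement, given `x`. -/
def preMeas (x : a) :
    Matrix ((((r × s) × a) × m) × y) ((((r × s) × a) × m) × y) ℂ :=
  (redRSA (G.σ1 x) ⊗ₖ G.τM) ⊗ₖ basisProj G.y0

/-- State of `RSAMYX` before the measurement. -/
def preMeasX : Matrix (((((r × s) × a) × m) × y) × a) (((((r × s) × a) × m) × y) × a) ℂ :=
  ∑ x, (G.pX x : ℂ) • (G.preMeas x ⊗ₖ basisProj x)

/-- State of `RSAMYX` after the measurement. -/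
def postMeasX : Matrix (((((r × s) × a) × m) × y) × a) (((((r × s) × a) × m) × y) × a) ℂ :=
  ∑ x, (G.pX x : ℂ) • (evolve splitSAMY (G.Umeas x) (G.preMeas x) ⊗ₖ basisProj x)

/-- Reduced state of `M`. -/
def redM (ρ : Matrix (((((r × s) × a) × m) × y) × a) (((((r × s) × a) × m) × y) × a) ℂ) :
    Matrix m m ℂ :=
  traceLeft (traceRight (traceRight ρ))

/-- The measurement heat `Q_meas`, the energy lost by the apparatus. -/
def heatMeas : ℝ := expect (redM G.preMeasX) G.HM - expect (redM G.postMeasX) G.HM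

/-- `Q_meas^Y = k_B T_m (ΔH(Y|X) - I(Y:M|X))`. -/
def heatMeasY : ℝ :=
  G.kB * G.Tm * (condEntropy (marginal splitYX G.postMeasX)
    - condEntropy (marginal splitYX G.preMeasX)
    - condMutualInfo (marginal splitYMX G.postMeasX))

/-- `Q_meas^{RSA|Y} = k_B T_m (ΔH(RSA|XY) - I(RSA:M|XY))`. -/
def heatMeasRSA : ℝ :=
  G.kB * G.Tm * (condEntropy (marginal splitQYX G.postMeasX)
    - condEntropy (marginal splitQYX G.preMeasX)
    - condMutualInfo (G.postMeasX.submatrix splitQMYX splitQMYX))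

/-! ### Heat, work and efficiency -/

/-- Heat absorbed from the hot bath. -/
def heatHot : ℝ := expect (redBh G.stateI) G.Hh - expect (redBh G.stateF) G.Hh

/-- Heat absorbed from the cold bath. -/
def heatCold : ℝ := expect (redBc G.stateI) G.Hc - expect (redBc G.stateF) G.Hc

/-- Heat `Q_erase^Y = ⟨H^Y⟩_i - ⟨H^Y⟩_f` of the erasure of `Y`. -/
def heatErase : ℝ := expect (redY G.stateI) G.HY - expect (redY G.stateF) G.HY

/-- Internal energy of `RSAY` (the reference has zero Hamiltonian) when the Hamiltonian of `SA`
is `H`. -/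
def internalEnergy (H : Matrix (s × a) (s × a) ℂ) (ρ : Op r s a bh bc y) : ℝ :=
  expect (redSA ρ) H + expect (redY ρ) G.HY

/-- Change `ΔU^{RSAY}` of the internal energy over the whole cycle. -/
def deltaU : ℝ := G.internalEnergy G.Hinit G.stateErase - G.internalEnergy G.Hinit G.stateI

/-- Work of the encoding. -/
def workEnc : ℝ := G.internalEnergy G.Henc G.stateEnc - G.internalEnergy G.Hinit G.state0

/-- Work of the syndrome measurement. -/
def workMeas : ℝ :=
  G.internalEnergy G.Henc G.state2 - G.internalEnergy G.Henc G.state1 - G.heatMeas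

/-- Work of the error correction. -/
def workDec : ℝ := G.internalEnergy G.Hinit G.state3 - G.internalEnergy G.Henc G.state2

/-- Total work `W_tot` performed on the engine. -/
def workTot : ℝ := G.workEnc + G.workMeas + G.workDec

/-- Heat input `Q_input = Q_h + Q_meas^Y`. -/
def heatInput : ℝ := G.heatHot + G.heatMeasY

/-- Efficiency `η = -W_tot / Q_input`. -/
def efficiency : ℝ := -G.workTot / G.heatInput

/-- Carnot efficiency `η_C = 1 - T_c / T_h`. -/
def carnot : ℝ := 1 - G.Tc / G.Th

end Engine

end

end QECEngine

/-! The bound is entropy bookkeeping over the cycle, combined with the first law.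

Given `x`, the state of `RSA` after the initial measurement is pure, so until the syndrome is read
`E` has exactly the entropy of the two baths. An instrument with recorded outcomes raises entropy by
at least minus the logarithm of its efficacy (`entropy_sub_log_efficacy_le`), and decoding and reset
are unitary given `x` and `y`. Averaging over `X`, whose Shannon entropy is that of `τA`, bounds
`H(EXY)` from below (`entropy_stateF_ge`). Conversely `H(EXY) = H(E) + H(X|E) + H(Y|EX)`, and
subadditivity bounds `H(E)` by the entropies of `RS`, `A`, `B_h` and `B_c`. The ancilla ends in
`τA`, so its term cancels. A bath that starts thermal loses at most `kT` times its entropy loss in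
energy (`entropy_sub_entropy_gibbs_le`). This gives `entropyExchange_ge`: `S_e ≥ Q_h/kT_h + Q_c/kT_c
+ efficacy term - H(X|E) - H(Y|EX)`.

It remains to bound `Q_c` below. The first law (`deltaU_eq`) expresses it through work and the other
heats. The second law for the apparatus (`heatMeas_le`) bounds `Q_meas` by `Q_meas^Y +
Q_meas^{RSA|Y}`, whose second term is negative enough by the fourth assumption, and `Q_erase`
contributes about `kT_c H(Y|X)` by the Landauer assumption. The latter compensates `H(Y|EX) ≤
H(Y|X)`, and what is left rearranges to the excess of the efficiency over Carnot. -/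

namespace QECEngine

open Matrix Real

set_option linter.unusedSectionVars false

/-! ### Spectral decompositions and entropy as a sum over eigenvalues -/

section Spectral

variable {ι κ ξ : Type*} [Fintype ι] [DecidableEq ι] [Fintype κ] [DecidableEq κ]
  [Fintype ξ] [DecidableEq ξ]

/-- `ρ = U diag(d) Uᴴ` with `U` unitary. -/
structure Diagonalizes (U : Matrix ι ι ℂ) (d : ι → ℝ) (ρ : Matrix ι ι ℂ) : Prop where
  unitary : Uᴴ * U = 1
  eq : ρ = U * diagonal (fun i => (d i : ℂ)) * Uᴴ

theorem Diagonalizes.unitary' {U : Matrix ι ι ℂ} {d : ι → ℝ} {ρ : Matrix ι ι ℂ}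
    (h : Diagonalizes U d ρ) : U * Uᴴ = 1 := mul_eq_one_comm.mp h.unitary

theorem Diagonalizes.conj_eq {U : Matrix ι ι ℂ} {d : ι → ℝ} {ρ : Matrix ι ι ℂ}
    (h : Diagonalizes U d ρ) : Uᴴ * ρ * U = diagonal (fun i => (d i : ℂ)) := by
  rw [h.eq]
  calc Uᴴ * (U * diagonal (fun i => (d i : ℂ)) * Uᴴ) * U
      = (Uᴴ * U) * diagonal (fun i => (d i : ℂ)) * (Uᴴ * U) := by simp only [Matrix.mul_assoc]
    _ = _ := by rw [h.unitary, Matrix.one_mul, Matrix.mul_one]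

theorem diagonalizes_eigenvectorUnitary {ρ : Matrix ι ι ℂ} (h : ρ.IsHermitian) :
    Diagonalizes (h.eigenvectorUnitary : Matrix ι ι ℂ) h.eigenvalues ρ where
  unitary := Unitary.coe_star_mul_self h.eigenvectorUnitary
  eq := by
    conv_lhs => rw [h.spectral_theorem, Unitary.conjStarAlgAut_apply]
    rfl

theorem exists_diagonalizes {ρ : Matrix ι ι ℂ} (h : ρ.IsHermitian) :
    ∃ U d, Diagonalizes U d ρ := ⟨_, _, diagonalizes_eigenvectorUnitary h⟩

theorem isHermitian_diagonal_ofReal (d : ι → ℝ) :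
    (diagonal (fun i => (d i : ℂ))).IsHermitian := by
  simp [Matrix.IsHermitian, diagonal_conjTranspose, Pi.star_def]

theorem Diagonalizes.isHermitian {U : Matrix ι ι ℂ} {d : ι → ℝ} {ρ : Matrix ι ι ℂ}
    (h : Diagonalizes U d ρ) : ρ.IsHermitian := by
  rw [h.eq]
  exact isHermitian_mul_mul_conjTranspose U (isHermitian_diagonal_ofReal d)

/-- The change of basis `Vᴴ * U` to Mathlib's eigenbasis intertwines the two diagonals, so its
nonzero entries only link equal eigenvalues; hence it also intertwines their images under `f`. This
frees entropies and thermal states from the chosen eigenbasis. -/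
theorem Diagonalizes.cfc {U : Matrix ι ι ℂ} {d : ι → ℝ} {ρ : Matrix ι ι ℂ}
    (h : Diagonalizes U d ρ) (f : ℝ → ℝ) : Diagonalizes U (f ∘ d) (cfc f ρ) where
  unitary := h.unitary
  eq := by
    have hρ := h.isHermitian
    have hV := diagonalizes_eigenvectorUnitary hρ
    set V : Matrix ι ι ℂ := (hρ.eigenvectorUnitary : Matrix ι ι ℂ) with hVdef
    have hc : _root_.cfc f ρ = V * diagonal (fun i => (f (hρ.eigenvalues i) : ℂ)) * Vᴴ := by
      rw [hρ.cfc_eq, IsHermitian.cfc, Unitary.conjStarAlgAut_apply]; rfl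
    have key : Vᴴ * U * diagonal (fun i => (d i : ℂ))
        = diagonal (fun i => (hρ.eigenvalues i : ℂ)) * (Vᴴ * U) := by
      have e : V * diagonal (fun i => (hρ.eigenvalues i : ℂ)) * Vᴴ
          = U * diagonal (fun i => (d i : ℂ)) * Uᴴ := hV.eq.symm.trans h.eq
      calc Vᴴ * U * diagonal (fun i => (d i : ℂ))
          = Vᴴ * (U * diagonal (fun i => (d i : ℂ)) * Uᴴ) * U := by
            simp only [Matrix.mul_assoc, h.unitary, Matrix.mul_one]
        _ = (Vᴴ * V) * diagonal (fun i => (hρ.eigenvalues i : ℂ)) * (Vᴴ * U) := by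
            rw [← e]; simp only [Matrix.mul_assoc]
        _ = _ := by rw [hV.unitary, Matrix.one_mul]
    have key' : Vᴴ * U * diagonal (fun i => (f (d i) : ℂ))
        = diagonal (fun i => (f (hρ.eigenvalues i) : ℂ)) * (Vᴴ * U) := by
      ext i j
      have := congrFun (congrFun key i) j
      rw [mul_diagonal, diagonal_mul] at this ⊢
      by_cases hz : (Vᴴ * U) i j = 0
      · simp [hz]
      · rw [mul_comm] at this
        have := mul_right_cancel₀ hz this
        rw [Complex.ofReal_inj.mp this, mul_comm]
    have : V * (Vᴴ * U * diagonal (fun i => (f (d i) : ℂ))) * Uᴴ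
        = V * (diagonal (fun i => (f (hρ.eigenvalues i) : ℂ)) * (Vᴴ * U)) * Uᴴ := by rw [key']
    rw [hc]
    calc _ = V * (diagonal (fun i => (f (hρ.eigenvalues i) : ℂ)) * (Vᴴ * U)) * Uᴴ := by
            simp only [Matrix.mul_assoc, h.unitary', Matrix.mul_one]
      _ = (V * Vᴴ) * U * diagonal (fun i => (f (d i) : ℂ)) * Uᴴ := by
            rw [← this]; simp only [Matrix.mul_assoc]
      _ = _ := by rw [hV.unitary', Matrix.one_mul]; rfl

theorem Diagonalizes.trace {U : Matrix ι ι ℂ} {d : ι → ℝ} {ρ : Matrix ι ι ℂ}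
    (h : Diagonalizes U d ρ) : ρ.trace = ∑ i, (d i : ℂ) := by
  rw [h.eq, Matrix.trace_mul_comm, ← Matrix.mul_assoc, h.unitary, Matrix.one_mul, trace_diagonal]

theorem Diagonalizes.mul {U : Matrix ι ι ℂ} {d d' : ι → ℝ} {ρ ρ' : Matrix ι ι ℂ}
    (h : Diagonalizes U d ρ) (h' : Diagonalizes U d' ρ') :
    Diagonalizes U (fun i => d i * d' i) (ρ * ρ') where
  unitary := h.unitary
  eq := by
    rw [h.eq, h'.eq]
    calc _ = U * diagonal (fun i => (d i : ℂ)) * (Uᴴ * U) * diagonal (fun i => (d' i : ℂ)) * Uᴴ := by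
            simp only [Matrix.mul_assoc]
      _ = _ := by
        rw [h.unitary, Matrix.mul_one, Matrix.mul_assoc U, diagonal_mul_diagonal]
        simp

theorem Diagonalizes.entropy {U : Matrix ι ι ℂ} {d : ι → ℝ} {ρ : Matrix ι ι ℂ}
    (h : Diagonalizes U d ρ) : entropy ρ = ∑ i, negMulLog (d i) := by
  rw [QECEngine.entropy, (h.mul (h.cfc Real.log)).trace, ← Complex.ofReal_sum, Complex.ofReal_re,
    ← Finset.sum_neg_distrib]
  simp [negMulLog]

theorem Diagonalizes.eigenvalue_eq {U : Matrix ι ι ℂ} {d : ι → ℝ} {ρ : Matrix ι ι ℂ}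
    (h : Diagonalizes U d ρ) (i : ι) : (d i : ℂ) = (Uᴴ * ρ * U) i i := by
  simp [h.conj_eq]

theorem Diagonalizes.nonneg {U : Matrix ι ι ℂ} {d : ι → ℝ} {ρ : Matrix ι ι ℂ}
    (h : Diagonalizes U d ρ) (hρ : ρ.PosSemidef) (i : ι) : 0 ≤ d i := by
  have := (hρ.conjTranspose_mul_mul_same U).diag_nonneg (i := i)
  rw [← h.eigenvalue_eq] at this
  exact_mod_cast this

theorem Diagonalizes.conj {U : Matrix ι ι ℂ} {d : ι → ℝ} {ρ : Matrix ι ι ℂ}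
    (h : Diagonalizes U d ρ) {V : Matrix ι ι ℂ} (hV : Vᴴ * V = 1) :
    Diagonalizes (V * U) d (V * ρ * Vᴴ) where
  unitary := by
    rw [conjTranspose_mul]
    calc _ = Uᴴ * (Vᴴ * V) * U := by simp only [Matrix.mul_assoc]
      _ = 1 := by rw [hV, Matrix.mul_one, h.unitary]
  eq := by rw [h.eq, conjTranspose_mul]; simp only [Matrix.mul_assoc]

theorem Diagonalizes.submatrix {U : Matrix ι ι ℂ} {d : ι → ℝ} {ρ : Matrix ι ι ℂ}
    (h : Diagonalizes U d ρ) (e : κ ≃ ι) :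
    Diagonalizes (U.submatrix e e) (d ∘ e) (ρ.submatrix e e) where
  unitary := by
    rw [conjTranspose_submatrix, submatrix_mul_equiv, h.unitary, submatrix_one_equiv]
  eq := by
    have : diagonal (fun i => ((d ∘ e) i : ℂ))
        = (diagonal (fun i => (d i : ℂ))).submatrix e e := by
      rw [submatrix_diagonal_equiv]; rfl
    rw [this, conjTranspose_submatrix, submatrix_mul_equiv, submatrix_mul_equiv, ← h.eq]

theorem Diagonalizes.kronecker {U : Matrix ι ι ℂ} {d : ι → ℝ} {ρ : Matrix ι ι ℂ}
    {V : Matrix κ κ ℂ} {c : κ → ℝ} {σ : Matrix κ κ ℂ}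
    (h : Diagonalizes U d ρ) (h' : Diagonalizes V c σ) :
    Diagonalizes (U ⊗ₖ V) (fun i => d i.1 * c i.2) (ρ ⊗ₖ σ) where
  unitary := by
    rw [conjTranspose_kronecker, ← mul_kronecker_mul, h.unitary, h'.unitary, one_kronecker_one]
  eq := by
    have : diagonal (fun i : ι × κ => ((d i.1 * c i.2 : ℝ) : ℂ))
        = diagonal (fun i => (d i : ℂ)) ⊗ₖ diagonal (fun i => (c i : ℂ)) := by
      rw [diagonal_kronecker_diagonal]; simp
    rw [this, conjTranspose_kronecker, ← mul_kronecker_mul, ← mul_kronecker_mul, ← h.eq, ← h'.eq]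

theorem sum_kronecker_basisProj (ρ : ξ → Matrix ι ι ℂ) :
    ∑ x, ρ x ⊗ₖ basisProj x = blockDiagonal ρ := by
  ext ⟨i, x⟩ ⟨j, x'⟩
  rw [Matrix.sum_apply, blockDiagonal_apply]
  simp only [kronecker_apply, basisProj, single_apply]
  by_cases h : x = x'
  · subst h
    rw [if_pos rfl, Finset.sum_eq_single x] <;> simp +contextual
  · simp only [if_neg h]
    refine Finset.sum_eq_zero fun k _ => ?_
    rw [if_neg, mul_zero]
    rintro ⟨rfl, rfl⟩; exact h rfl

/-- A classical register makes the matrix block diagonal, so eigenbases of the blocks assemble into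
one of the whole. -/
theorem Diagonalizes.cq {U : ξ → Matrix ι ι ℂ} {d : ξ → ι → ℝ} {ρ : ξ → Matrix ι ι ℂ}
    (h : ∀ x, Diagonalizes (U x) (d x) (ρ x)) (p : ξ → ℝ) :
    Diagonalizes (blockDiagonal U) (fun i => p i.2 * d i.2 i.1)
      (∑ x, (p x : ℂ) • (ρ x ⊗ₖ basisProj x)) where
  unitary := by
    rw [blockDiagonal_conjTranspose, ← blockDiagonal_mul, ← blockDiagonal_one]
    congr 1; funext x; exact (h x).unitary
  eq := by
    simp only [← smul_kronecker]
    rw [sum_kronecker_basisProj (fun x => (p x : ℂ) • ρ x)]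
    have : diagonal (fun i : ι × ξ => ((p i.2 * d i.2 i.1 : ℝ) : ℂ))
        = blockDiagonal (fun x => diagonal (fun i => ((p x * d x i : ℝ) : ℂ))) := by
      rw [blockDiagonal_diagonal]
    rw [this, blockDiagonal_conjTranspose, ← blockDiagonal_mul, ← blockDiagonal_mul]
    congr 1; funext x
    have : diagonal (fun i => ((p x * d x i : ℝ) : ℂ))
        = (p x : ℂ) • diagonal (fun i => (d x i : ℂ)) := by
      rw [← diagonal_smul]; congr 1; funext i; simp
    rw [this, Matrix.mul_smul, Matrix.smul_mul, ← (h x).eq]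

theorem entropy_conj {ρ V : Matrix ι ι ℂ} (hρ : ρ.IsHermitian) (hV : Vᴴ * V = 1) :
    entropy (V * ρ * Vᴴ) = entropy ρ := by
  obtain ⟨U, d, h⟩ := exists_diagonalizes hρ
  rw [(h.conj hV).entropy, h.entropy]

theorem entropy_submatrix {ρ : Matrix ι ι ℂ} (hρ : ρ.IsHermitian) {f : κ → ι}
    (hf : Function.Bijective f) : entropy (ρ.submatrix f f) = entropy ρ := by
  obtain ⟨U, d, h⟩ := exists_diagonalizes hρ
  have := (h.submatrix (Equiv.ofBijective f hf)).entropy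
  rw [Equiv.coe_ofBijective] at this
  rw [this, h.entropy]
  exact (Equiv.ofBijective f hf).sum_comp (fun i => negMulLog (d i))

theorem entropy_cq {ρ : ξ → Matrix ι ι ℂ} (hρ : ∀ x, (ρ x).IsHermitian)
    (htr : ∀ x, (ρ x).trace = 1) (p : ξ → ℝ) :
    entropy (∑ x, (p x : ℂ) • (ρ x ⊗ₖ basisProj x))
      = ∑ x, negMulLog (p x) + ∑ x, p x * entropy (ρ x) := by
  choose U d h using fun x => exists_diagonalizes (hρ x)
  rw [(Diagonalizes.cq h p).entropy, Fintype.sum_prod_type_right, ← Finset.sum_add_distrib]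
  refine Finset.sum_congr rfl fun x _ => ?_
  have h1 : ∑ i, d x i = 1 := by
    have := (h x).trace
    rw [htr x, ← Complex.ofReal_sum] at this
    exact_mod_cast this.symm
  simp only [negMulLog_mul, Finset.sum_add_distrib, ← Finset.sum_mul, h1, one_mul,
    ← Finset.mul_sum, ← (h x).entropy]

theorem entropy_kronecker {ρ : Matrix ι ι ℂ} {σ : Matrix κ κ ℂ} (hρ : ρ.IsHermitian)
    (hσ : σ.IsHermitian) (h1 : ρ.trace = 1) (h2 : σ.trace = 1) :
    entropy (ρ ⊗ₖ σ) = entropy ρ + entropy σ := by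
  obtain ⟨U, d, h⟩ := exists_diagonalizes hρ
  obtain ⟨V, c, h'⟩ := exists_diagonalizes hσ
  have e1 : ∑ i, d i = 1 := by
    have := h.trace
    rw [h1, ← Complex.ofReal_sum] at this
    exact_mod_cast this.symm
  have e2 : ∑ i, c i = 1 := by
    have := h'.trace
    rw [h2, ← Complex.ofReal_sum] at this
    exact_mod_cast this.symm
  rw [(h.kronecker h').entropy, h.entropy, h'.entropy, Fintype.sum_prod_type]
  simp only [negMulLog_mul, Finset.sum_add_distrib, ← Finset.sum_mul, ← Finset.mul_sum, e1, e2,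
    one_mul]

/-- The eigenvalues are 0 or 1, where `negMulLog` vanishes. -/
theorem entropy_eq_zero_of_idempotent {ρ : Matrix ι ι ℂ} (hρ : ρ.IsHermitian)
    (h2 : ρ * ρ = ρ) : entropy ρ = 0 := by
  obtain ⟨U, d, h⟩ := exists_diagonalizes hρ
  rw [h.entropy]
  refine Finset.sum_eq_zero fun i _ => ?_
  have e : ((d i * d i : ℝ) : ℂ) = (d i : ℂ) := by
    rw [(h.mul h).eigenvalue_eq i, h2, h.eigenvalue_eq]
  have e' : d i * d i = d i := by exact_mod_cast e
  have e2 : d i * (d i - 1) = 0 := by linarith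
  rcases mul_eq_zero.mp e2 with h0 | h0
  · simp [h0]
  · simp [sub_eq_zero.mp h0]

end Spectral

/-! ### Entropy inequalities: pinching, subadditivity, free energy, efficacy -/

section Inequalities

variable {ι κ μ ν : Type*} [Fintype ι] [DecidableEq ι] [Fintype κ] [DecidableEq κ]
  [Fintype μ] [DecidableEq μ] [Fintype ν] [DecidableEq ν]

theorem Diagonalizes.trace_mul {U : Matrix ι ι ℂ} {d : ι → ℝ} {ρ : Matrix ι ι ℂ}
    (h : Diagonalizes U d ρ) (A : Matrix ι ι ℂ) :
    (ρ * A).trace = ∑ i, (d i : ℂ) * (Uᴴ * A * U) i i := by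
  rw [h.eq]
  calc _ = (diagonal (fun i => (d i : ℂ)) * (Uᴴ * A * U)).trace := by
        rw [Matrix.mul_assoc, Matrix.mul_assoc, Matrix.trace_mul_comm]
        simp only [Matrix.mul_assoc]
    _ = _ := by simp [Matrix.trace, diagonal_mul]

theorem Diagonalizes.trace_mul_re {U : Matrix ι ι ℂ} {d : ι → ℝ} {ρ : Matrix ι ι ℂ}
    (h : Diagonalizes U d ρ) (A : Matrix ι ι ℂ) :
    (ρ * A).trace.re = ∑ i, d i * ((Uᴴ * A * U) i i).re := by
  rw [h.trace_mul, Complex.re_sum]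
  simp

theorem Diagonalizes.sum_eq_one {U : Matrix ι ι ℂ} {d : ι → ℝ} {ρ : Matrix ι ι ℂ}
    (h : Diagonalizes U d ρ) (htr : ρ.trace = 1) : ∑ i, d i = 1 := by
  have := h.trace
  rw [htr, ← Complex.ofReal_sum] at this
  exact_mod_cast this.symm

theorem trace_conj {U A : Matrix ι ι ℂ} (hU : U * Uᴴ = 1) : (Uᴴ * A * U).trace = A.trace := by
  rw [Matrix.trace_mul_comm, ← Matrix.mul_assoc, hU, Matrix.one_mul]

theorem re_diag_nonneg {A : Matrix ι ι ℂ} (hA : A.PosSemidef) (i : ι) : 0 ≤ (A i i).re :=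
  (Complex.le_def.mp (hA.diag_nonneg (i := i))).1

/-- Passing to the diagonal in any orthonormal basis does not decrease the entropy. -/
theorem entropy_le_sum_negMulLog_diag {ρ V : Matrix ι ι ℂ} (hρ : ρ.PosSemidef)
    (hV : Vᴴ * V = 1) : entropy ρ ≤ ∑ i, negMulLog ((Vᴴ * ρ * V) i i).re := by
  obtain ⟨U, d, h⟩ := exists_diagonalizes hρ.1
  have hd := h.nonneg hρ
  have hV' : V * Vᴴ = 1 := mul_eq_one_comm.mp hV
  -- The squared moduli of the entries of the unitary `W` form a doubly stochastic matrix that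
  -- averages the eigenvalues into the diagonal. Column sums expand the entropy; row sums feed
  -- Jensen's inequality.
  set W := Vᴴ * U with hW
  have hW1 : W * Wᴴ = 1 := by
    rw [hW, conjTranspose_mul, conjTranspose_conjTranspose]
    calc _ = Vᴴ * (U * Uᴴ) * V := by simp only [Matrix.mul_assoc]
      _ = 1 := by rw [h.unitary', Matrix.mul_one, hV]
  have hW2 : Wᴴ * W = 1 := mul_eq_one_comm.mp hW1
  have hrow : ∀ i, ∑ j, Complex.normSq (W i j) = 1 := fun i => by
    have := congrFun (congrFun hW1 i) i
    simp only [mul_apply, conjTranspose_apply, one_apply_eq, RCLike.star_def,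
      Complex.mul_conj] at this
    exact_mod_cast this
  have hcol : ∀ j, ∑ i, Complex.normSq (W i j) = 1 := fun j => by
    have := congrFun (congrFun hW2 j) j
    simp only [mul_apply, conjTranspose_apply, one_apply_eq, RCLike.star_def] at this
    simp only [mul_comm _ (W _ _), Complex.mul_conj] at this
    exact_mod_cast this
  have hdiag : ∀ i, ((Vᴴ * ρ * V) i i).re = ∑ j, Complex.normSq (W i j) * d j := fun i => by
    have e : Vᴴ * ρ * V = W * diagonal (fun i => (d i : ℂ)) * Wᴴ := by
      rw [h.eq, hW, conjTranspose_mul, conjTranspose_conjTranspose]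
      simp only [Matrix.mul_assoc]
    rw [e, mul_apply, Complex.re_sum]
    refine Finset.sum_congr rfl fun j _ => ?_
    rw [mul_diagonal, conjTranspose_apply, RCLike.star_def, mul_right_comm, Complex.mul_conj,
      ← Complex.ofReal_mul, Complex.ofReal_re]
  rw [h.entropy]
  calc ∑ j, negMulLog (d j) = ∑ j, ∑ i, Complex.normSq (W i j) * negMulLog (d j) := by
        refine Finset.sum_congr rfl fun j _ => ?_
        rw [← Finset.sum_mul, hcol, one_mul]
    _ = ∑ i, ∑ j, Complex.normSq (W i j) * negMulLog (d j) := Finset.sum_comm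
    _ ≤ _ := Finset.sum_le_sum fun i _ => by
        rw [hdiag]
        exact concaveOn_negMulLog.le_map_sum (fun j _ => Complex.normSq_nonneg _) (hrow i)
          (fun j _ => hd j)

/-- Pointwise form of the nonnegativity of relative entropy: `log u ≤ u - 1` at `u = t / q`. Where
`q = 0`, the left side is zero. -/
theorem negMulLog_add_mul_log_le {q t : ℝ} (hq : 0 ≤ q) (ht : 0 ≤ t) (h : 0 < q → 0 < t) :
    negMulLog q + q * log t ≤ t - q := by
  rcases hq.eq_or_lt with rfl | hq
  · simpa using ht
  · have ht := h hq
    have := log_le_sub_one_of_pos (div_pos ht hq)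
    rw [log_div ht.ne' hq.ne'] at this
    have h2 := mul_le_mul_of_nonneg_left this hq.le
    have h3 : q * (t / q - 1) = t - q := by field_simp
    rw [h3] at h2
    rw [negMulLog]
    linarith

/-- The partial trace is cyclic in the factor being traced out, so `C` and `D` meet there and
cancel. -/
theorem traceRight_conj_kronecker (ρ : Matrix (ι × κ) (ι × κ) ℂ) (A B : Matrix ι ι ℂ)
    {C D : Matrix κ κ ℂ} (h : D * C = 1) :
    traceRight ((A ⊗ₖ C) * ρ * (B ⊗ₖ D)) = A * traceRight ρ * B := by
  ext i j
  have h' : ∀ b b', ∑ k, D b k * C k b' = if b = b' then 1 else 0 := fun b b' => by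
    rw [← mul_apply, h, one_apply]
  simp only [traceRight, of_apply, mul_apply, kronecker_apply, Fintype.sum_prod_type,
    Finset.sum_mul, Finset.mul_sum]
  rw [Finset.sum_comm]
  refine Finset.sum_congr rfl fun x _ => ?_
  calc _ = ∑ y, ∑ z, ∑ w, (∑ k, D y k * C k w) * (A i z * ρ (z, w) (x, y) * B x j) := by
        simp only [Finset.sum_mul]
        rw [Finset.sum_comm]
        refine Finset.sum_congr rfl fun y _ => ?_
        rw [Finset.sum_comm]
        refine Finset.sum_congr rfl fun z _ => ?_
        rw [Finset.sum_comm]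
        refine Finset.sum_congr rfl fun w _ => Finset.sum_congr rfl fun k _ => by ring
    _ = _ := by
        simp only [h', ite_mul, one_mul, zero_mul, Finset.sum_ite_eq, Finset.mem_univ, if_true]
        rw [Finset.sum_comm]

theorem traceLeft_eq_traceRight_swap (ρ : Matrix (ι × κ) (ι × κ) ℂ) :
    traceLeft ρ = traceRight (ρ.submatrix Prod.swap Prod.swap) := rfl

theorem traceLeft_conj_kronecker (ρ : Matrix (ι × κ) (ι × κ) ℂ) (A B : Matrix κ κ ℂ)
    {C D : Matrix ι ι ℂ} (h : D * C = 1) :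
    traceLeft ((C ⊗ₖ A) * ρ * (D ⊗ₖ B)) = A * traceLeft ρ * B := by
  rw [traceLeft_eq_traceRight_swap, traceLeft_eq_traceRight_swap,
    ← traceRight_conj_kronecker _ A B h]
  congr 1
  have : ∀ M N : Matrix (ι × κ) (ι × κ) ℂ, (M * N).submatrix Prod.swap Prod.swap
      = M.submatrix Prod.swap (Prod.swap : κ × ι → ι × κ) * N.submatrix Prod.swap Prod.swap :=
    fun M N => (submatrix_mul_equiv M N Prod.swap (Equiv.prodComm κ ι) Prod.swap).symm
  rw [this, this]
  congr 1
  · congr 1; ext ⟨i, j⟩ ⟨k, l⟩; simp [mul_comm]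
  · ext ⟨i, j⟩ ⟨k, l⟩; simp [mul_comm]

theorem trace_traceRight (ρ : Matrix (ι × κ) (ι × κ) ℂ) : (traceRight ρ).trace = ρ.trace := by
  simp [Matrix.trace, traceRight, Fintype.sum_prod_type]

theorem trace_traceLeft (ρ : Matrix (ι × κ) (ι × κ) ℂ) : (traceLeft ρ).trace = ρ.trace := by
  simp [Matrix.trace, traceLeft, Fintype.sum_prod_type_right]

theorem posSemidef_traceRight {ρ : Matrix (ι × κ) (ι × κ) ℂ} (h : ρ.PosSemidef) :
    (traceRight ρ).PosSemidef := by
  have : traceRight ρ = ∑ k, ρ.submatrix (fun i => (i, k)) (fun i => (i, k)) := by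
    ext i j; simp [traceRight, Matrix.sum_apply]
  rw [this]
  exact posSemidef_sum _ fun k _ => h.submatrix _

theorem posSemidef_traceLeft {ρ : Matrix (ι × κ) (ι × κ) ℂ} (h : ρ.PosSemidef) :
    (traceLeft ρ).PosSemidef := posSemidef_traceRight (h.submatrix Prod.swap)

/-- Subadditivity of the von Neumann entropy. -/
theorem entropy_le_add {ρ : Matrix (ι × κ) (ι × κ) ℂ} (hρ : ρ.PosSemidef) (htr : ρ.trace = 1) :
    entropy ρ ≤ entropy (traceRight ρ) + entropy (traceLeft ρ) := by
  have hR := posSemidef_traceRight hρ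
  have hL := posSemidef_traceLeft hρ
  obtain ⟨U, d, h⟩ := exists_diagonalizes hR.1
  obtain ⟨V, c, h'⟩ := exists_diagonalizes hL.1
  have hT : (U ⊗ₖ V)ᴴ * (U ⊗ₖ V) = 1 := by
    rw [conjTranspose_kronecker, ← mul_kronecker_mul, h.unitary, h'.unitary, one_kronecker_one]
  -- In the product of the eigenbases of the marginals, the diagonal of the state is a classical
  -- joint distribution `q` whose marginals are the spectra `d` and `c`. Pinching to `q` does not
  -- lower the entropy, and the rest is classical subadditivity, comparing `q` with `d i * c j`.
  set τ := (U ⊗ₖ V)ᴴ * ρ * (U ⊗ₖ V) with hτ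
  have hτp : τ.PosSemidef := hρ.conjTranspose_mul_mul_same _
  have hτR : traceRight τ = diagonal (fun i => (d i : ℂ)) := by
    rw [hτ, conjTranspose_kronecker, traceRight_conj_kronecker _ _ _ h'.unitary', h.conj_eq]
  have hτL : traceLeft τ = diagonal (fun i => (c i : ℂ)) := by
    rw [hτ, conjTranspose_kronecker, traceLeft_conj_kronecker _ _ _ h.unitary', h'.conj_eq]
  set q : ι → κ → ℝ := fun i j => (τ (i, j) (i, j)).re with hq
  have hq0 : ∀ i j, 0 ≤ q i j := fun i j => re_diag_nonneg hτp (i, j)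
  have hqd : ∀ i, ∑ j, q i j = d i := fun i => by
    have := congrArg Complex.re (congrFun (congrFun hτR i) i)
    simpa [traceRight] using this
  have hqc : ∀ j, ∑ i, q i j = c j := fun j => by
    have := congrArg Complex.re (congrFun (congrFun hτL j) j)
    simpa [traceLeft] using this
  have hd1 : ∑ i, d i = 1 := h.sum_eq_one (by rw [trace_traceRight, htr])
  have hc1 : ∑ i, c i = 1 := h'.sum_eq_one (by rw [trace_traceLeft, htr])
  have hqd_le : ∀ i j, q i j ≤ d i := fun i j => by
    rw [← hqd]; exact Finset.single_le_sum (fun j _ => hq0 i j) (Finset.mem_univ j)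
  have hqc_le : ∀ i j, q i j ≤ c j := fun i j => by
    rw [← hqc]; exact Finset.single_le_sum (f := fun i => q i j) (fun i _ => hq0 i j)
      (Finset.mem_univ i)
  have hd0 : ∀ i, 0 ≤ d i := h.nonneg hR
  have hc0 : ∀ i, 0 ≤ c i := h'.nonneg hL
  have key : ∀ i j, negMulLog (q i j) + (q i j * log (d i) + q i j * log (c j))
      ≤ d i * c j - q i j := fun i j => by
    rcases (hq0 i j).eq_or_lt with h0 | h0
    · rw [← h0]; simpa using mul_nonneg (hd0 i) (hc0 j)
    · have h1 := h0.trans_le (hqd_le i j)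
      have h2 := h0.trans_le (hqc_le i j)
      have := negMulLog_add_mul_log_le (hq0 i j) (mul_pos h1 h2).le fun _ => mul_pos h1 h2
      rwa [log_mul h1.ne' h2.ne', mul_add] at this
  have hsum := Finset.sum_le_sum fun i (_ : i ∈ Finset.univ) =>
    Finset.sum_le_sum fun j (_ : j ∈ Finset.univ) => key i j
  have e1 : ∑ i, ∑ j, q i j * log (d i) = -entropy (traceRight ρ) := by
    rw [h.entropy, ← Finset.sum_neg_distrib]
    refine Finset.sum_congr rfl fun i _ => ?_
    rw [← Finset.sum_mul, hqd, negMulLog]; ring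
  have e2 : ∑ i, ∑ j, q i j * log (c j) = -entropy (traceLeft ρ) := by
    rw [h'.entropy, ← Finset.sum_neg_distrib, Finset.sum_comm]
    refine Finset.sum_congr rfl fun i _ => ?_
    rw [← Finset.sum_mul, hqc, negMulLog]; ring
  have e3 : ∑ i, ∑ j, (d i * c j - q i j) = 0 := by
    simp only [Finset.sum_sub_distrib, ← Finset.mul_sum, hqd, hc1, mul_one, sub_self,
      Finset.sum_const_zero]
  have e4 := entropy_le_sum_negMulLog_diag hρ hT
  rw [Fintype.sum_prod_type] at e4
  simp only [Finset.sum_add_distrib] at hsum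
  rw [e1, e2, e3] at hsum
  have e5 : ∑ i, ∑ j, negMulLog ((((U ⊗ₖ V)ᴴ * ρ * (U ⊗ₖ V)) (i, j) (i, j)).re)
      = ∑ i, ∑ j, negMulLog (q i j) := rfl
  linarith

theorem Diagonalizes.gibbs {U : Matrix ι ι ℂ} {E : ι → ℝ} {H : Matrix ι ι ℂ}
    (h : Diagonalizes U E H) (β : ℝ) :
    Diagonalizes U (fun i => Real.exp (-β * E i) / ∑ j, Real.exp (-β * E j)) (gibbs β H) where
  unitary := h.unitary
  eq := by
    have h' := h.cfc (fun t => Real.exp (-β * t))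
    have e : diagonal (fun i => ((Real.exp (-β * E i) / ∑ j, Real.exp (-β * E j) : ℝ) : ℂ))
        = (∑ j, Real.exp (-β * E j) : ℂ)⁻¹ • diagonal (fun i => (Real.exp (-β * E i) : ℂ)) := by
      rw [← diagonal_smul]; congr 1; funext i
      simp [div_eq_inv_mul]
    rw [QECEngine.gibbs, h'.trace, e, Matrix.mul_smul, Matrix.smul_mul]
    conv_lhs => rw [h'.eq]
    simp

theorem partition_pos [Nonempty ι] (β : ℝ) (E : ι → ℝ) : 0 < ∑ j, Real.exp (-β * E j) :=
  Finset.sum_pos (fun _ _ => Real.exp_pos _) Finset.univ_nonempty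

theorem trace_gibbs [Nonempty ι] (β : ℝ) {H : Matrix ι ι ℂ} (hH : H.IsHermitian) :
    (gibbs β H).trace = 1 := by
  obtain ⟨U, E, h⟩ := exists_diagonalizes hH
  rw [(h.gibbs β).trace, ← Complex.ofReal_sum, ← Finset.sum_div,
    div_self (partition_pos β E).ne', Complex.ofReal_one]

theorem Diagonalizes.posSemidef {U : Matrix ι ι ℂ} {d : ι → ℝ} {ρ : Matrix ι ι ℂ}
    (h : Diagonalizes U d ρ) (hd : ∀ i, 0 ≤ d i) : ρ.PosSemidef := by
  rw [h.eq]
  exact (PosSemidef.diagonal (fun i => by simpa using hd i)).mul_mul_conjTranspose_same U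

theorem posSemidef_gibbs (β : ℝ) {H : Matrix ι ι ℂ} (hH : H.IsHermitian) :
    (gibbs β H).PosSemidef := by
  obtain ⟨U, E, h⟩ := exists_diagonalizes hH
  exact (h.gibbs β).posSemidef fun i => by positivity

theorem gibbs_diagonal (β : ℝ) (E : ι → ℝ) :
    gibbs β (diagonal fun i => (E i : ℂ))
      = diagonal fun i => ((Real.exp (-β * E i) / ∑ j, Real.exp (-β * E j) : ℝ) : ℂ) := by
  have h : Diagonalizes 1 E (diagonal fun i => (E i : ℂ)) := ⟨by simp, by simp⟩
  simpa using (h.gibbs β).eq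

/-- The thermal state minimizes the free energy. -/
theorem entropy_sub_entropy_gibbs_le [Nonempty ι] (β : ℝ) {H ρ : Matrix ι ι ℂ}
    (hH : H.IsHermitian) (hρ : ρ.PosSemidef) (htr : ρ.trace = 1) :
    entropy ρ - entropy (gibbs β H) ≤ β * (expect ρ H - expect (gibbs β H) H) := by
  obtain ⟨U, E, h⟩ := exists_diagonalizes hH
  have hg := h.gibbs β
  set Z := ∑ j, Real.exp (-β * E j) with hZ
  have hZ0 : 0 < Z := partition_pos β E
  set t : ι → ℝ := fun i => Real.exp (-β * E i) / Z with ht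
  have ht0 : ∀ i, 0 < t i := fun i => div_pos (Real.exp_pos _) hZ0
  have ht1 : ∑ i, t i = 1 := by rw [ht, ← Finset.sum_div, div_self hZ0.ne']
  have hlog : ∀ i, log (t i) = -β * E i - log Z := fun i => by
    rw [ht, log_div (Real.exp_pos _).ne' hZ0.ne', log_exp]
  -- The energy depends only on the diagonal in an eigenbasis of `H`, so by pinching it suffices to
  -- compare the distributions `q` and `t`; `log (t i)` is affine in the energy.
  set q : ι → ℝ := fun i => ((Uᴴ * ρ * U) i i).re with hq
  have hq0 : ∀ i, 0 ≤ q i := fun i => re_diag_nonneg (hρ.conjTranspose_mul_mul_same U) i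
  have hq1 : ∑ i, q i = 1 := by
    have := congrArg Complex.re (trace_conj (A := ρ) h.unitary')
    rw [htr] at this
    simpa [Matrix.trace] using this
  have hE : ∀ σ : Matrix ι ι ℂ, expect σ H = ∑ i, ((Uᴴ * σ * U) i i).re * E i := fun σ => by
    rw [expect, Matrix.trace_mul_comm, h.trace_mul_re]
    simp only [mul_comm]
  have e1 : expect ρ H = ∑ i, q i * E i := hE ρ
  have e2 : expect (gibbs β H) H = ∑ i, t i * E i := by
    rw [hE]; refine Finset.sum_congr rfl fun i _ => ?_
    rw [← hg.eigenvalue_eq, Complex.ofReal_re]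
  have e3 : entropy (gibbs β H) = β * ∑ i, t i * E i + log Z := by
    rw [hg.entropy]
    simp only [negMulLog, hlog]
    calc _ = ∑ i, (β * (t i * E i) + t i * log Z) := Finset.sum_congr rfl fun i _ => by ring
      _ = _ := by rw [Finset.sum_add_distrib, ← Finset.mul_sum, ← Finset.sum_mul, ht1, one_mul]
  have e4 : entropy ρ ≤ ∑ i, negMulLog (q i) := entropy_le_sum_negMulLog_diag hρ h.unitary
  have e5 := Finset.sum_le_sum fun i (_ : i ∈ Finset.univ) =>
    negMulLog_add_mul_log_le (hq0 i) (ht0 i).le fun _ => ht0 i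
  rw [Finset.sum_add_distrib, Finset.sum_sub_distrib, ht1, hq1] at e5
  have e6 : ∑ i, q i * log (t i) = -β * ∑ i, q i * E i - log Z := by
    simp only [hlog]
    calc _ = ∑ i, (-β * (q i * E i) - q i * log Z) := Finset.sum_congr rfl fun i _ => by ring
      _ = _ := by rw [Finset.sum_sub_distrib, ← Finset.mul_sum, ← Finset.sum_mul, hq1, one_mul]
  rw [e1, e2, e3]
  linarith

theorem posSemidef_basisProj (i : ι) : (basisProj i : Matrix ι ι ℂ).PosSemidef := by
  rw [basisProj, ← diagonal_single]
  refine PosSemidef.diagonal fun j => ?_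
  by_cases hij : j = i
  · subst hij; simp
  · simp [hij]

theorem trace_basisProj (i : ι) : (basisProj i : Matrix ι ι ℂ).trace = 1 := by
  simp [basisProj]

/-- The entropy gain of a positive trace-preserving map is at least the negative logarithm of
its efficacy. -/
theorem entropy_sub_log_efficacy_le {Φ : Matrix ι ι ℂ →ₗ[ℂ] Matrix κ κ ℂ}
    (hpos : ∀ σ : Matrix ι ι ℂ, σ.PosSemidef → (Φ σ).PosSemidef)
    (htp : ∀ σ : Matrix ι ι ℂ, (Φ σ).trace = σ.trace) {ρ : Matrix ι ι ℂ}
    (hρ : ρ.PosSemidef) (htr : ρ.trace = 1) :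
    entropy ρ - log (efficacy Φ ρ) ≤ entropy (Φ ρ) := by
  obtain ⟨U, p, h⟩ := exists_diagonalizes hρ.1
  obtain ⟨V, q, h'⟩ := exists_diagonalizes (hpos ρ hρ).1
  have hp0 := h.nonneg hρ
  have hp1 := h.sum_eq_one htr
  have hq0 := h'.nonneg (hpos ρ hρ)
  have hq1 := h'.sum_eq_one ((htp ρ).trans htr)
  set P : ι → Matrix ι ι ℂ := fun i => U * basisProj i * Uᴴ with hP
  have hPp : ∀ i, (P i).PosSemidef := fun i => (posSemidef_basisProj i).mul_mul_conjTranspose_same U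
  have hPt : ∀ i, (P i).trace = 1 := fun i => by
    rw [hP, Matrix.trace_mul_comm, ← Matrix.mul_assoc, h.unitary, Matrix.one_mul,
      trace_basisProj]
  have hρP : ρ = ∑ i, (p i : ℂ) • P i := by
    conv_lhs => rw [h.eq, ← sum_single_eq_diagonal]
    rw [Finset.mul_sum, Finset.sum_mul]
    refine Finset.sum_congr rfl fun i _ => ?_
    rw [hP, ← Matrix.smul_mul, ← Matrix.mul_smul, basisProj, smul_single, smul_eq_mul, mul_one]
  have h1P : (1 : Matrix ι ι ℂ) = ∑ i, P i := by
    have : (1 : Matrix ι ι ℂ) = ∑ i, basisProj i := by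
      simp only [basisProj]
      rw [← diagonal_one, ← sum_single_eq_diagonal]
    rw [hP, ← Finset.sum_mul, ← Finset.mul_sum, ← this, Matrix.mul_one, h.unitary']
  -- Between the eigenbases of `ρ` and `Φ ρ` the map becomes a classical transition matrix: `q = W
  -- p`, and trace preservation gives `∑ j, W j i = 1`. The sums over `i` are free, and the efficacy
  -- records them as `∑ W j i * q j`.
  set W : κ → ι → ℝ := fun j i => ((Vᴴ * Φ (P i) * V) j j).re with hW
  have hW0 : ∀ j i, 0 ≤ W j i := fun j i =>
    re_diag_nonneg ((hpos _ (hPp i)).conjTranspose_mul_mul_same V) j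
  have hW1 : ∀ i, ∑ j, W j i = 1 := fun i => by
    have := congrArg Complex.re (trace_conj (A := Φ (P i)) h'.unitary')
    rw [htp, hPt] at this
    simpa [Matrix.trace] using this
  have hq : ∀ j, q j = ∑ i, p i * W j i := fun j => by
    have := congrArg Complex.re (h'.eigenvalue_eq j)
    rw [Complex.ofReal_re] at this
    rw [this, hρP, map_sum, Finset.mul_sum, Finset.sum_mul, Matrix.sum_apply, Complex.re_sum]
    refine Finset.sum_congr rfl fun i _ => ?_
    rw [map_smul, Matrix.mul_smul, Matrix.smul_mul, Matrix.smul_apply, smul_eq_mul,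
      Complex.re_ofReal_mul]
  have hZ : efficacy Φ ρ = ∑ i, ∑ j, W j i * q j := by
    have : (adjointMap Φ (Φ ρ)).trace = (Φ ρ * Φ 1).trace := by
      rw [trace_adjointMap, Matrix.mul_one]
    rw [efficacy, this, h'.trace_mul_re, Finset.sum_comm]
    refine Finset.sum_congr rfl fun j _ => ?_
    rw [h1P, map_sum, Finset.mul_sum, Finset.sum_mul, Matrix.sum_apply, Complex.re_sum,
      Finset.mul_sum]
    exact Finset.sum_congr rfl fun i _ => mul_comm _ _
  set Z := efficacy Φ ρ with hZdef
  have hp_le : ∀ i, p i ≤ 1 := fun i => by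
    rw [← hp1]; exact Finset.single_le_sum (fun j _ => hp0 j) (Finset.mem_univ i)
  -- Since `p i ≤ 1`, `Z` is at least the purity `∑ q j ^ 2` of the output, which is positive.
  have hZ0 : 0 < Z := by
    have hle : ∑ j, q j * q j ≤ Z := by
      rw [hZ, Finset.sum_comm]
      refine Finset.sum_le_sum fun j _ => ?_
      nth_rewrite 1 [hq j]
      rw [Finset.sum_mul]
      exact Finset.sum_le_sum fun i _ => mul_le_mul_of_nonneg_right
        (mul_le_of_le_one_left (hW0 j i) (hp_le i)) (hq0 j)
    refine lt_of_lt_of_le ?_ hle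
    obtain ⟨j, -, hj⟩ : ∃ j ∈ Finset.univ, q j ≠ 0 :=
      Finset.exists_ne_zero_of_sum_ne_zero (by rw [hq1]; exact one_ne_zero)
    exact Finset.sum_pos' (fun j _ => mul_self_nonneg _)
      ⟨j, Finset.mem_univ j, mul_self_pos.mpr hj⟩
  -- This is `log u ≤ u - 1` at `u = q j / (p i * Z)`, weighted by `p i * W j i`. Dividing by `Z`
  -- makes both terms on the right sum to 1. Where `p i = 0` the left side vanishes and the right is
  -- nonnegative, so `ρ` need not have full rank.
  have key : ∀ i j, p i * W j i * log (q j) - p i * W j i * log (p i) - p i * W j i * log Z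
      ≤ W j i * q j / Z - p i * W j i := fun i j => by
    rcases (hp0 i).eq_or_lt with h0 | h0
    · rw [← h0]
      have := div_nonneg (mul_nonneg (hW0 j i) (hq0 j)) hZ0.le
      simpa using this
    rcases (hW0 j i).eq_or_lt with h1 | h1
    · rw [← h1]; simp
    have h2 : 0 < q j := lt_of_lt_of_le (mul_pos h0 h1) (by
      rw [hq j]
      exact Finset.single_le_sum (f := fun i => p i * W j i)
        (fun i _ => mul_nonneg (hp0 i) (hW0 j i)) (Finset.mem_univ i))
    have h3 := log_le_sub_one_of_pos (div_pos h2 (mul_pos h0 hZ0))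
    rw [log_div h2.ne' (mul_pos h0 hZ0).ne', log_mul h0.ne' hZ0.ne'] at h3
    have h4 := mul_le_mul_of_nonneg_left h3 (mul_pos h0 h1).le
    have h5 : p i * W j i * (q j / (p i * Z) - 1) = W j i * q j / Z - p i * W j i := by
      field_simp
    rw [h5] at h4
    linarith
  have hsum := Finset.sum_le_sum fun i (_ : i ∈ Finset.univ) =>
    Finset.sum_le_sum fun j (_ : j ∈ Finset.univ) => key i j
  simp only [Finset.sum_sub_distrib] at hsum
  have e1 : ∑ i, ∑ j, p i * W j i * log (q j) = -entropy (Φ ρ) := by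
    rw [h'.entropy, ← Finset.sum_neg_distrib, Finset.sum_comm]
    refine Finset.sum_congr rfl fun j _ => ?_
    rw [← Finset.sum_mul, ← hq, negMulLog]; ring
  have e2 : ∑ i, ∑ j, p i * W j i * log (p i) = -entropy ρ := by
    rw [h.entropy, ← Finset.sum_neg_distrib]
    refine Finset.sum_congr rfl fun i _ => ?_
    rw [← Finset.sum_mul, ← Finset.mul_sum, hW1, negMulLog]; ring
  have e3 : ∑ i, ∑ j, p i * W j i = 1 := by
    simp only [← Finset.mul_sum, hW1, mul_one, hp1]
  have e4 : ∑ i, ∑ j, p i * W j i * log Z = log Z := by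
    simp only [← Finset.sum_mul]; rw [e3, one_mul]
  have e5 : ∑ i, ∑ j, W j i * q j / Z = 1 := by
    simp only [← Finset.sum_div]; rw [← hZ, div_self hZ0.ne']
  rw [e1, e2, e3, e4, e5] at hsum
  linarith

end Inequalities

/-! ### States, local evolutions, partial traces and instruments -/

section Systems

variable {ι κ μ ν ξ : Type*} [Fintype ι] [DecidableEq ι] [Fintype κ] [DecidableEq κ]
  [Fintype μ] [DecidableEq μ] [Fintype ν] [DecidableEq ν] [Fintype ξ] [DecidableEq ξ]

/-- A density matrix. -/
structure IsState (ρ : Matrix ι ι ℂ) : Prop where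
  posSemidef : ρ.PosSemidef
  trace_eq : ρ.trace = 1

theorem IsState.isHermitian {ρ : Matrix ι ι ℂ} (h : IsState ρ) : ρ.IsHermitian := h.posSemidef.1

theorem IsState.kronecker {ρ : Matrix ι ι ℂ} {σ : Matrix κ κ ℂ} (h : IsState ρ)
    (h' : IsState σ) : IsState (ρ ⊗ₖ σ) :=
  ⟨h.posSemidef.kronecker h'.posSemidef, by rw [trace_kronecker, h.trace_eq, h'.trace_eq, mul_one]⟩

theorem IsState.entropy_kronecker {ρ : Matrix ι ι ℂ} {σ : Matrix κ κ ℂ} (h : IsState ρ)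
    (h' : IsState σ) : entropy (ρ ⊗ₖ σ) = entropy ρ + entropy σ :=
  QECEngine.entropy_kronecker h.isHermitian h'.isHermitian h.trace_eq h'.trace_eq

theorem IsState.traceRight {ρ : Matrix (ι × κ) (ι × κ) ℂ} (h : IsState ρ) :
    IsState (traceRight ρ) := ⟨posSemidef_traceRight h.posSemidef, by rw [trace_traceRight, h.trace_eq]⟩

theorem IsState.traceLeft {ρ : Matrix (ι × κ) (ι × κ) ℂ} (h : IsState ρ) :
    IsState (traceLeft ρ) := ⟨posSemidef_traceLeft h.posSemidef, by rw [trace_traceLeft, h.trace_eq]⟩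

theorem trace_submatrix_of_bijective (ρ : Matrix ι ι ℂ) {f : κ → ι} (hf : Function.Bijective f) :
    (ρ.submatrix f f).trace = ρ.trace :=
  (Equiv.ofBijective f hf).sum_comp (fun i => ρ i i)

theorem IsState.submatrix {ρ : Matrix ι ι ℂ} (h : IsState ρ) {f : κ → ι}
    (hf : Function.Bijective f) : IsState (ρ.submatrix f f) :=
  ⟨h.posSemidef.submatrix f, by rw [trace_submatrix_of_bijective ρ hf, h.trace_eq]⟩

theorem IsState.marginal {ρ : Matrix ι ι ℂ} (h : IsState ρ) (e : ι ≃ κ × ν) :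
    IsState (marginal e ρ) := (h.submatrix e.symm.bijective).traceRight

theorem IsState.conj {ρ V : Matrix ι ι ℂ} (h : IsState ρ) (hV : Vᴴ * V = 1) :
    IsState (V * ρ * Vᴴ) :=
  ⟨h.posSemidef.mul_mul_conjTranspose_same V, by
    rw [Matrix.trace_mul_comm, ← Matrix.mul_assoc, hV, Matrix.one_mul, h.trace_eq]⟩

theorem isState_basisProj (i : ι) : IsState (basisProj i : Matrix ι ι ℂ) :=
  ⟨posSemidef_basisProj i, trace_basisProj i⟩

theorem isState_gibbs [Nonempty ι] (β : ℝ) {H : Matrix ι ι ℂ} (hH : H.IsHermitian) :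
    IsState (gibbs β H) := ⟨posSemidef_gibbs β hH, trace_gibbs β hH⟩

theorem isState_pureState {ψ : ι → ℂ} (h : ∑ i, ‖ψ i‖ ^ 2 = 1) : IsState (pureState ψ) :=
  ⟨posSemidef_vecMulVec_self_star ψ, by
    rw [pureState, trace_vecMulVec, dotProduct]
    simp only [Pi.star_apply, RCLike.star_def, Complex.mul_conj, Complex.normSq_eq_norm_sq]
    rw [← Complex.ofReal_sum, h, Complex.ofReal_one]⟩

theorem entropy_pureState {ψ : ι → ℂ} (h : ∑ i, ‖ψ i‖ ^ 2 = 1) : entropy (pureState ψ) = 0 := by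
  refine entropy_eq_zero_of_idempotent (isState_pureState h).isHermitian ?_
  have : star ψ ⬝ᵥ ψ = 1 := by
    have := (isState_pureState h).trace_eq
    rwa [pureState, trace_vecMulVec, dotProduct_comm] at this
  rw [pureState, vecMulVec_mul_vecMulVec, this, one_smul]

theorem entropy_basisProj (i : ι) : entropy (basisProj i : Matrix ι ι ℂ) = 0 :=
  entropy_eq_zero_of_idempotent (posSemidef_basisProj i).1 (by simp [basisProj])

theorem entropy_diagonal (d : ι → ℝ) :
    entropy (diagonal fun i => (d i : ℂ)) = ∑ i, negMulLog (d i) :=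
  Diagonalizes.entropy (U := 1) ⟨by simp, by simp⟩

theorem IsState.sum_smul {p : ξ → ℝ} (hp : ∀ x, 0 ≤ p x) (hp1 : ∑ x, p x = 1)
    {ρ : ξ → Matrix ι ι ℂ} (h : ∀ x, IsState (ρ x)) : IsState (∑ x, (p x : ℂ) • ρ x) where
  posSemidef := posSemidef_sum _ fun x _ => (h x).posSemidef.smul (by exact_mod_cast hp x)
  trace_eq := by
    rw [trace_sum]
    simp only [trace_smul, (h _).trace_eq, smul_eq_mul, mul_one]
    rw [← Complex.ofReal_sum, hp1, Complex.ofReal_one]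

theorem unitary_star_mul (U : Matrix.unitaryGroup κ ℂ) :
    (U : Matrix κ κ ℂ)ᴴ * (U : Matrix κ κ ℂ) = 1 := Unitary.coe_star_mul_self U

theorem lift_star_mul (e : ι ≃ κ × ν) (U : Matrix.unitaryGroup κ ℂ) :
    (lift e (U : Matrix κ κ ℂ))ᴴ * lift e (U : Matrix κ κ ℂ) = 1 := by
  rw [lift, conjTranspose_submatrix, submatrix_mul_equiv, conjTranspose_kronecker,
    ← mul_kronecker_mul, unitary_star_mul, conjTranspose_one, Matrix.mul_one, one_kronecker_one,
    submatrix_one_equiv]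

theorem IsState.evolve {ρ : Matrix ι ι ℂ} (h : IsState ρ) (e : ι ≃ κ × ν)
    (U : Matrix.unitaryGroup κ ℂ) : IsState (evolve e U ρ) := h.conj (lift_star_mul e U)

theorem entropy_evolve {ρ : Matrix ι ι ℂ} (h : IsState ρ) (e : ι ≃ κ × ν)
    (U : Matrix.unitaryGroup κ ℂ) : entropy (evolve e U ρ) = entropy ρ :=
  entropy_conj h.isHermitian (lift_star_mul e U)

theorem evolve_sum_smul (e : ι ≃ κ × ν) (U : Matrix.unitaryGroup κ ℂ) (p : ξ → ℂ)
    (ρ : ξ → Matrix ι ι ℂ) :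
    evolve e U (∑ x, p x • ρ x) = ∑ x, p x • evolve e U (ρ x) := by
  simp only [evolve, Finset.mul_sum, Finset.sum_mul, Matrix.mul_smul, Matrix.smul_mul]

theorem evolve_sum (e : ι ≃ κ × ν) (U : Matrix.unitaryGroup κ ℂ) (ρ : ξ → Matrix ι ι ℂ) :
    evolve e U (∑ x, ρ x) = ∑ x, evolve e U (ρ x) := by
  simp only [evolve, Finset.mul_sum, Finset.sum_mul]

theorem evolve_submatrix (e : ι ≃ κ × ν) (U : Matrix.unitaryGroup κ ℂ) (ρ : Matrix ι ι ℂ) :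
    (evolve e U ρ).submatrix e.symm e.symm
      = ((U : Matrix κ κ ℂ) ⊗ₖ (1 : Matrix ν ν ℂ)) * ρ.submatrix e.symm e.symm
        * ((U : Matrix κ κ ℂ)ᴴ ⊗ₖ (1 : Matrix ν ν ℂ)) := by
  rw [evolve, ← submatrix_mul_equiv _ _ e.symm e.symm e.symm,
    ← submatrix_mul_equiv _ _ e.symm e.symm e.symm, lift, conjTranspose_submatrix,
    conjTranspose_kronecker, conjTranspose_one]
  simp only [submatrix_submatrix, Equiv.self_comp_symm, submatrix_id_id]

theorem marginal_evolve (e : ι ≃ κ × ν) (U : Matrix.unitaryGroup κ ℂ) (ρ : Matrix ι ι ℂ) :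
    marginal e (evolve e U ρ) = (U : Matrix κ κ ℂ) * marginal e ρ * (U : Matrix κ κ ℂ)ᴴ := by
  rw [marginal, evolve_submatrix, traceRight_conj_kronecker _ _ _ (Matrix.mul_one 1), marginal]

/-- Reduced state on the subsystem `ν` of `ι ≃ κ × ν`. -/
noncomputable def spectator (e : ι ≃ κ × ν) (ρ : Matrix ι ι ℂ) : Matrix ν ν ℂ :=
  traceLeft (ρ.submatrix e.symm e.symm)

/-- No signalling: this carries bath states past the stages in which they do not take part. -/
theorem spectator_evolve (e : ι ≃ κ × ν) (U : Matrix.unitaryGroup κ ℂ) (ρ : Matrix ι ι ℂ) :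
    spectator e (evolve e U ρ) = spectator e ρ := by
  rw [spectator, evolve_submatrix, traceLeft_conj_kronecker _ _ _ (unitary_star_mul U),
    Matrix.one_mul, Matrix.mul_one, spectator]

theorem traceRight_sum (ρ : ξ → Matrix (ι × κ) (ι × κ) ℂ) :
    traceRight (∑ x, ρ x) = ∑ x, traceRight (ρ x) := by
  ext i j; simp only [traceRight, of_apply, Matrix.sum_apply]; exact Finset.sum_comm

theorem traceLeft_sum (ρ : ξ → Matrix (ι × κ) (ι × κ) ℂ) :
    traceLeft (∑ x, ρ x) = ∑ x, traceLeft (ρ x) := by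
  ext i j; simp only [traceLeft, of_apply, Matrix.sum_apply]; exact Finset.sum_comm

theorem traceRight_smul (c : ℂ) (ρ : Matrix (ι × κ) (ι × κ) ℂ) :
    traceRight (c • ρ) = c • traceRight ρ := by
  ext i j; simp [traceRight, Finset.mul_sum]

theorem traceLeft_smul (c : ℂ) (ρ : Matrix (ι × κ) (ι × κ) ℂ) :
    traceLeft (c • ρ) = c • traceLeft ρ := by
  ext i j; simp [traceLeft, Finset.mul_sum]

theorem traceRight_kronecker (ρ : Matrix ι ι ℂ) (σ : Matrix κ κ ℂ) :
    traceRight (ρ ⊗ₖ σ) = σ.trace • ρ := by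
  ext i j; simp [traceRight, Matrix.trace, ← Finset.mul_sum, mul_comm]

theorem traceLeft_kronecker (ρ : Matrix ι ι ℂ) (σ : Matrix κ κ ℂ) :
    traceLeft (ρ ⊗ₖ σ) = ρ.trace • σ := by
  ext i j; simp [traceLeft, Matrix.trace, ← Finset.sum_mul]

theorem spectator_sum (e : ι ≃ κ × ν) (ρ : ξ → Matrix ι ι ℂ) :
    spectator e (∑ x, ρ x) = ∑ x, spectator e (ρ x) := by
  simp only [spectator]
  rw [← traceLeft_sum]; congr 1; ext i j; simp [Matrix.sum_apply]

theorem spectator_smul (e : ι ≃ κ × ν) (c : ℂ) (ρ : Matrix ι ι ℂ) :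
    spectator e (c • ρ) = c • spectator e ρ := by
  simp only [spectator]
  rw [← traceLeft_smul]; rfl

/-- A unitary which commutes with the total Hamiltonian conserves the total energy. -/
theorem expect_conserved {U : Matrix.unitaryGroup (ι × κ) ℂ} {H : Matrix ι ι ℂ}
    {K : Matrix κ κ ℂ}
    (h : Commute (U : Matrix (ι × κ) (ι × κ) ℂ)
      (H ⊗ₖ (1 : Matrix κ κ ℂ) + (1 : Matrix ι ι ℂ) ⊗ₖ K)) (ρ : Matrix (ι × κ) (ι × κ) ℂ) :
    expect ((U : Matrix (ι × κ) (ι × κ) ℂ) * ρ * (U : Matrix (ι × κ) (ι × κ) ℂ)ᴴ)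
      (H ⊗ₖ (1 : Matrix κ κ ℂ) + (1 : Matrix ι ι ℂ) ⊗ₖ K)
      = expect ρ (H ⊗ₖ (1 : Matrix κ κ ℂ) + (1 : Matrix ι ι ℂ) ⊗ₖ K) := by
  set T := H ⊗ₖ (1 : Matrix κ κ ℂ) + (1 : Matrix ι ι ℂ) ⊗ₖ K
  rw [expect, expect]
  congr 1
  have hc : (U : Matrix (ι × κ) (ι × κ) ℂ)ᴴ * T * (U : Matrix (ι × κ) (ι × κ) ℂ) = T := by
    rw [Matrix.mul_assoc, ← h.eq, ← Matrix.mul_assoc, unitary_star_mul, Matrix.one_mul]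
  rw [Matrix.mul_assoc, Matrix.mul_assoc, Matrix.trace_mul_comm, Matrix.mul_assoc, hc]

theorem expect_add_local (ρ : Matrix (ι × κ) (ι × κ) ℂ) (H : Matrix ι ι ℂ) (K : Matrix κ κ ℂ) :
    expect ρ (H ⊗ₖ (1 : Matrix κ κ ℂ) + (1 : Matrix ι ι ℂ) ⊗ₖ K)
      = expect (traceRight ρ) H + expect (traceLeft ρ) K := by
  rw [expect, expect, expect, Matrix.mul_add, trace_add, Complex.add_re]
  congr 2
  · simp only [Matrix.trace, diag_apply, mul_apply, traceRight, of_apply, Fintype.sum_prod_type,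
      kronecker_apply, one_apply, mul_ite, mul_one, mul_zero, Finset.sum_ite_eq',
      Finset.mem_univ, if_true, Finset.sum_mul]
    exact Finset.sum_congr rfl fun i _ => Finset.sum_comm
  · simp only [Matrix.trace, diag_apply, mul_apply, traceLeft, of_apply,
      Fintype.sum_prod_type_right, kronecker_apply, one_apply, ite_mul, mul_ite, one_mul, mul_zero,
      zero_mul, Finset.sum_ite_eq', Finset.mem_univ, if_true, Finset.sum_mul]
    exact Finset.sum_congr rfl fun i _ => Finset.sum_comm

theorem tensorId_submatrix_right (N : Matrix κ κ ℂ →ₗ[ℂ] Matrix μ μ ℂ) (f : ξ → ν)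
    (ρ : Matrix (κ × ν) (κ × ν) ℂ) :
    (tensorId N ν ρ).submatrix (Prod.map id f) (Prod.map id f)
      = tensorId N ξ (ρ.submatrix (Prod.map id f) (Prod.map id f)) := rfl

/-- The definition only tests ancillas `Fin n`; an arbitrary finite one is reached by reindexing. -/
theorem IsCompletelyPositive.tensorId {N : Matrix κ κ ℂ →ₗ[ℂ] Matrix μ μ ℂ}
    (h : IsCompletelyPositive N) {ρ : Matrix (κ × ν) (κ × ν) ℂ} (hρ : ρ.PosSemidef) :
    (tensorId N ν ρ).PosSemidef := by
  have e := Fintype.equivFin ν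
  have h1 := (h (Fintype.card ν) _ (hρ.submatrix (Prod.map id e.symm))).submatrix (Prod.map id e)
  rw [tensorId_submatrix_right, submatrix_submatrix] at h1
  simpa [Prod.map_comp_map] using h1

/-- The memory is classical, so moving its index outermost leaves one block per outcome; positivity
and trace can then be checked blockwise. -/
theorem tensorId_instrumentMap (N : ξ → Matrix κ κ ℂ →ₗ[ℂ] Matrix κ κ ℂ)
    (ρ : Matrix (κ × ν) (κ × ν) ℂ) :
    tensorId (instrumentMap N) ν ρ
      = (blockDiagonal fun y => tensorId (N y) ν ρ).submatrix
          (fun q : (κ × ξ) × ν => ((q.1.1, q.2), q.1.2)) (fun q => ((q.1.1, q.2), q.1.2)) := by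
  ext ⟨⟨k, y⟩, v⟩ ⟨⟨k', y'⟩, v'⟩
  rw [← sum_kronecker_basisProj]
  simp [tensorId, instrumentMap, Matrix.sum_apply]

theorem posSemidef_blockDiagonal {ρ : ξ → Matrix ι ι ℂ} (h : ∀ x, (ρ x).PosSemidef) :
    (blockDiagonal ρ).PosSemidef := by
  rw [← sum_kronecker_basisProj]
  exact posSemidef_sum _ fun x _ => (h x).kronecker (posSemidef_basisProj x)

theorem IsInstrument.posSemidef_tensorId {N : ξ → Matrix κ κ ℂ →ₗ[ℂ] Matrix κ κ ℂ}
    (h : IsInstrument N) {ρ : Matrix (κ × ν) (κ × ν) ℂ} (hρ : ρ.PosSemidef) :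
    (tensorId (instrumentMap N) ν ρ).PosSemidef := by
  rw [tensorId_instrumentMap]
  exact (posSemidef_blockDiagonal fun y => (h.completelyPositive y).tensorId hρ).submatrix _

/-- No signalling for an instrument whose outcome is ignored: trace preservation of the sum, applied
to each matrix entry of the spectator. -/
theorem IsInstrument.sum_traceLeft {N : ξ → Matrix κ κ ℂ →ₗ[ℂ] Matrix κ κ ℂ}
    (h : IsInstrument N) (ρ : Matrix (κ × ν) (κ × ν) ℂ) :
    ∑ y, traceLeft (tensorId (N y) ν ρ) = traceLeft ρ := by
  ext v v'
  have := h.trace_eq (of fun k k' => ρ (k, v) (k', v'))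
  rw [trace_sum] at this
  rw [Matrix.sum_apply]
  exact this

theorem trace_blockDiagonal_eq_sum (ρ : ξ → Matrix ι ι ℂ) :
    (blockDiagonal ρ).trace = ∑ x, (ρ x).trace := by
  simp [Matrix.trace, Fintype.sum_prod_type_right, blockDiagonal_apply]

theorem IsInstrument.trace_tensorId {N : ξ → Matrix κ κ ℂ →ₗ[ℂ] Matrix κ κ ℂ}
    (h : IsInstrument N) (ρ : Matrix (κ × ν) (κ × ν) ℂ) :
    (tensorId (instrumentMap N) ν ρ).trace = ρ.trace := by
  have hf : Function.Bijective (fun q : (κ × ξ) × ν => ((q.1.1, q.2), q.1.2)) :=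
    (⟨_, fun q => ((q.1.1, q.2), q.1.2), fun _ => rfl, fun _ => rfl⟩ :
      (κ × ξ) × ν ≃ (κ × ν) × ξ).bijective
  rw [tensorId_instrumentMap, trace_submatrix_of_bijective _ hf, trace_blockDiagonal_eq_sum,
    ← trace_traceLeft ρ, ← h.sum_traceLeft, trace_sum]
  simp only [trace_traceLeft]

theorem traceRight_blockDiagonal (ρ : ξ → Matrix ι ι ℂ) :
    traceRight (blockDiagonal ρ) = ∑ x, ρ x := by
  ext i j; simp [traceRight, Matrix.sum_apply]

theorem traceLeft_blockDiagonal (ρ : ξ → Matrix ι ι ℂ) :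
    traceLeft (blockDiagonal ρ) = diagonal fun x => (ρ x).trace := by
  rw [← sum_kronecker_basisProj, traceLeft_sum, ← sum_single_eq_diagonal]
  simp only [traceLeft_kronecker, basisProj, smul_single, smul_eq_mul, mul_one]

theorem blockDiagonal_conj (V ρ : ξ → Matrix ι ι ℂ) :
    (blockDiagonal fun x => V x * ρ x * (V x)ᴴ)
      = blockDiagonal V * blockDiagonal ρ * (blockDiagonal V)ᴴ := by
  rw [blockDiagonal_conjTranspose, ← blockDiagonal_mul, ← blockDiagonal_mul]

theorem blockDiagonal_star_mul {V : ξ → Matrix ι ι ℂ} (h : ∀ x, (V x)ᴴ * V x = 1) :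
    (blockDiagonal V)ᴴ * blockDiagonal V = 1 := by
  rw [blockDiagonal_conjTranspose, ← blockDiagonal_mul, ← blockDiagonal_one]
  congr 1; funext x; exact h x

theorem sum_smul_basisProj (p : ξ → ℂ) : ∑ x, p x • basisProj x = diagonal p := by
  simp only [basisProj, smul_single, smul_eq_mul, mul_one, sum_single_eq_diagonal]

end Systems

set_option synthInstance.maxSize 1024
set_option synthInstance.maxHeartbeats 200000

/-! ### Thermal states and the ancilla distribution -/

namespace Engine

variable {r s a bh bc m y : Type*}
  [Fintype r] [DecidableEq r] [Fintype s] [DecidableEq s] [Fintype a] [DecidableEq a]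
  [Fintype bh] [DecidableEq bh] [Fintype bc] [DecidableEq bc] [Fintype m] [DecidableEq m]
  [Fintype y] [DecidableEq y]

variable (G : Engine r s a bh bc m y)

theorem isHermitian_HA : G.HA.IsHermitian := isHermitian_diagonal_ofReal _

theorem τA_eq : G.τA = diagonal fun x => (G.pX x : ℂ) := gibbs_diagonal _ _

theorem pX_nonneg (x : a) : 0 ≤ G.pX x := by unfold pX; positivity

theorem sum_pX [Nonempty a] : ∑ x, G.pX x = 1 := by
  unfold pX
  rw [← Finset.sum_div, div_self (partition_pos _ _).ne']

theorem isState_τA [Nonempty a] : IsState G.τA := isState_gibbs _ G.isHermitian_HA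

theorem isState_τh [Nonempty bh] : IsState G.τh := isState_gibbs _ G.Hh_herm

theorem isState_τc [Nonempty bc] : IsState G.τc := isState_gibbs _ G.Hc_herm

theorem isState_τM [Nonempty m] : IsState G.τM := isState_gibbs _ G.HM_herm

/-! ### Entropies along the cycle, given the value of `X` -/

section Conditional

theorem isState_σ0 [Nonempty bh] [Nonempty bc] (x : a) : IsState (G.σ0 x) :=
  (((isState_pureState G.ψ_unit).kronecker (isState_basisProj x)).kronecker
    G.isState_τh).kronecker G.isState_τc

theorem entropy_σ0 [Nonempty bh] [Nonempty bc] (x : a) :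
    entropy (G.σ0 x) = entropy G.τh + entropy G.τc := by
  have h1 := isState_pureState G.ψ_unit
  have h2 : IsState (basisProj x : Matrix a a ℂ) := isState_basisProj x
  rw [σ0, ((h1.kronecker h2).kronecker G.isState_τh).entropy_kronecker G.isState_τc,
    (h1.kronecker h2).entropy_kronecker G.isState_τh, h1.entropy_kronecker h2,
    entropy_pureState G.ψ_unit, entropy_basisProj]
  ring

theorem isState_σenc [Nonempty bh] [Nonempty bc] (x : a) : IsState (G.σenc x) :=
  (G.isState_σ0 x).evolve _ _

theorem isState_σ1 [Nonempty bh] [Nonempty bc] (x : a) : IsState (G.σ1 x) :=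
  (G.isState_σenc x).evolve _ _

theorem entropy_σ1 [Nonempty bh] [Nonempty bc] (x : a) :
    entropy (G.σ1 x) = entropy G.τh + entropy G.τc := by
  rw [σ1, entropy_evolve (G.isState_σenc x), σenc, entropy_evolve (G.isState_σ0 x), entropy_σ0]

/-- `SAY` inside `EY`. -/
def splitSAY : Sys r s a bh bc × y ≃ ((s × a) × y) × ((r × bh) × bc) :=
  ⟨fun q => (((splitSA q.1).1, q.2), (splitSA q.1).2),
   fun q => (splitSA.symm (q.1.1, q.2), q.1.2), fun _ => rfl, fun _ => rfl⟩

/-- Links the unnormalized branches `σ2 x k` to the single map whose efficacy occurs in the theorem.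
-/
theorem blockDiagonal_σ2 (x : a) :
    blockDiagonal (G.σ2 x)
      = (tensorId (instrumentMap (G.N x)) ((r × bh) × bc)
          ((G.σ1 x).submatrix splitSA.symm splitSA.symm)).submatrix splitSAY splitSAY := by
  rw [tensorId_instrumentMap]
  rfl

theorem isState_σ2 [Nonempty bh] [Nonempty bc] (x : a) : IsState (blockDiagonal (G.σ2 x)) := by
  have h := (G.isState_σ1 x).submatrix
    (splitSA : Sys r s a bh bc ≃ (s × a) × ((r × bh) × bc)).symm.bijective
  rw [blockDiagonal_σ2]
  exact IsState.submatrix ⟨(G.N_instrument x).posSemidef_tensorId h.posSemidef,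
    ((G.N_instrument x).trace_tensorId _).trans h.trace_eq⟩ splitSAY.bijective

/-- Encoding and noise are unitary, so the state entering the instrument still has just the entropy
of the baths; the efficacy bound does the rest. -/
theorem entropy_gain [Nonempty bh] [Nonempty bc] (x : a) :
    entropy G.τh + entropy G.τc - log (G.instrumentEfficacy x)
      ≤ entropy (blockDiagonal (G.σ2 x)) := by
  have hb := (splitSA : Sys r s a bh bc ≃ (s × a) × ((r × bh) × bc)).symm.bijective
  have h := (G.isState_σ1 x).submatrix hb
  have hpos := (G.N_instrument x).posSemidef_tensorId (ν := (r × bh) × bc) h.posSemidef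
  rw [blockDiagonal_σ2, entropy_submatrix hpos.1 splitSAY.bijective, ← G.entropy_σ1 x,
    ← entropy_submatrix (G.isState_σ1 x).isHermitian hb]
  exact entropy_sub_log_efficacy_le (fun _ => (G.N_instrument x).posSemidef_tensorId)
    (G.N_instrument x).trace_tensorId h.posSemidef h.trace_eq

theorem blockDiagonal_σ3 (x : a) : blockDiagonal (G.σ3 x)
    = blockDiagonal (fun k => lift splitSA (G.Udec x k : Matrix (s × a) (s × a) ℂ))
      * blockDiagonal (G.σ2 x)
      * (blockDiagonal fun k => lift splitSA (G.Udec x k : Matrix (s × a) (s × a) ℂ))ᴴ :=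
  blockDiagonal_conj _ _

theorem blockDiagonal_σf (x : a) : blockDiagonal (G.σf x)
    = blockDiagonal (fun _ => lift splitAc (G.Uc : Matrix (a × bc) (a × bc) ℂ))
      * blockDiagonal (G.σ3 x)
      * (blockDiagonal fun _ => lift splitAc (G.Uc : Matrix (a × bc) (a × bc) ℂ))ᴴ :=
  blockDiagonal_conj _ _

theorem isState_σ3 [Nonempty bh] [Nonempty bc] (x : a) : IsState (blockDiagonal (G.σ3 x)) := by
  rw [blockDiagonal_σ3]
  exact (G.isState_σ2 x).conj (blockDiagonal_star_mul fun _ => lift_star_mul _ _)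

theorem isState_σf [Nonempty bh] [Nonempty bc] (x : a) : IsState (blockDiagonal (G.σf x)) := by
  rw [blockDiagonal_σf]
  exact (G.isState_σ3 x).conj (blockDiagonal_star_mul fun _ => lift_star_mul _ _)

/-- A unitary controlled by `Y` is a block diagonal unitary on `EY`. -/
theorem entropy_σf [Nonempty bh] [Nonempty bc] (x : a) :
    entropy (blockDiagonal (G.σf x)) = entropy (blockDiagonal (G.σ2 x)) := by
  rw [blockDiagonal_σf, entropy_conj (G.isState_σ3 x).isHermitian
    (blockDiagonal_star_mul fun _ => lift_star_mul _ _), blockDiagonal_σ3,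
    entropy_conj (G.isState_σ2 x).isHermitian (blockDiagonal_star_mul fun _ => lift_star_mul _ _)]

theorem trace_evolve {ι κ ν : Type*} [Fintype ι] [DecidableEq ι] [Fintype κ] [DecidableEq κ]
    [Fintype ν] [DecidableEq ν] (e : ι ≃ κ × ν) (U : Matrix.unitaryGroup κ ℂ)
    (ρ : Matrix ι ι ℂ) : (evolve e U ρ).trace = ρ.trace := by
  rw [evolve, Matrix.trace_mul_comm, ← Matrix.mul_assoc, lift_star_mul, Matrix.one_mul]

theorem trace_σ3 (x : a) (k : y) : (G.σ3 x k).trace = (G.σ2 x k).trace := trace_evolve _ _ _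

theorem trace_σf (x : a) (k : y) : (G.σf x k).trace = (G.σ2 x k).trace :=
  (trace_evolve _ _ _).trans (G.trace_σ3 x k)

theorem traceLeft_σf (x : a) :
    traceLeft (blockDiagonal (G.σf x)) = traceLeft (blockDiagonal (G.σ2 x)) := by
  simp only [traceLeft_blockDiagonal, trace_σf]

end Conditional

/-! ### Averaging over `X`: entropies with the classical registers -/

section Registers

variable (ρ : a → y → Matrix (Sys r s a bh bc) (Sys r s a bh bc) ℂ)

/-- With `X` outermost and `Y` absorbed into the blocks, the state has the form required by
`entropy_cq`. -/
theorem cqState_submatrix :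
    (G.cqState ρ).submatrix
        (fun q : (Sys r s a bh bc × y) × a => ((q.1.1, q.2), q.1.2))
        (fun q => ((q.1.1, q.2), q.1.2))
      = ∑ x, (G.pX x : ℂ) • (blockDiagonal (ρ x) ⊗ₖ basisProj x) := by
  ext ⟨⟨i, k⟩, x⟩ ⟨⟨i', k'⟩, x'⟩
  simp only [← sum_kronecker_basisProj, cqState, submatrix_apply, Matrix.sum_apply, Matrix.smul_apply,
    kronecker_apply, smul_eq_mul, Finset.sum_mul, Finset.mul_sum]
  exact Finset.sum_congr rfl fun _ _ => Finset.sum_congr rfl fun _ _ => by ring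

theorem isHermitian_cq {ι ξ : Type*} [Fintype ι] [DecidableEq ι] [Fintype ξ] [DecidableEq ξ]
    {p : ξ → ℝ} (hp : ∀ x, 0 ≤ p x) {ρ : ξ → Matrix ι ι ℂ} (h : ∀ x, IsState (ρ x)) :
    (∑ x, (p x : ℂ) • (ρ x ⊗ₖ basisProj x)).IsHermitian :=
  (posSemidef_sum _ fun x _ => ((h x).kronecker (isState_basisProj x)).posSemidef.smul
    (by exact_mod_cast hp x)).1

theorem entropy_cqState {ρ : a → y → Matrix (Sys r s a bh bc) (Sys r s a bh bc) ℂ}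
    (h : ∀ x, IsState (blockDiagonal (ρ x))) :
    (G.cqState ρ).IsHermitian ∧ entropy (G.cqState ρ)
      = ∑ x, negMulLog (G.pX x) + ∑ x, G.pX x * entropy (blockDiagonal (ρ x)) := by
  let e : (Sys r s a bh bc × y) × a ≃ (Sys r s a bh bc × a) × y :=
    ⟨fun q => ((q.1.1, q.2), q.1.2), fun q => ((q.1.1, q.2), q.1.2), fun _ => rfl, fun _ => rfl⟩
  have h1 := isHermitian_cq G.pX_nonneg h
  have h2 : G.cqState ρ
      = (∑ x, (G.pX x : ℂ) • (blockDiagonal (ρ x) ⊗ₖ basisProj x)).submatrix e.symm e.symm := by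
    rw [← cqState_submatrix]; rfl
  rw [h2]
  exact ⟨h1.submatrix _, by
    rw [entropy_submatrix h1 e.symm.bijective, entropy_cq (fun x => (h x).isHermitian)
      fun x => (h x).trace_eq]⟩

theorem traceRight_cqState :
    traceRight (G.cqState ρ)
      = ∑ x, (G.pX x : ℂ) • (traceRight (blockDiagonal (ρ x)) ⊗ₖ basisProj x) := by
  simp only [cqState, traceRight_sum, traceRight_smul, traceRight_kronecker, trace_basisProj,
    one_smul, traceRight_blockDiagonal]
  refine Finset.sum_congr rfl fun x _ => ?_
  rw [← Finset.smul_sum]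
  congr 1
  ext ⟨i, k⟩ ⟨i', k'⟩
  simp [Matrix.sum_apply, Finset.sum_mul]

theorem redE_cqState : redE (G.cqState ρ) = ∑ x, (G.pX x : ℂ) • ∑ k, ρ x k := by
  rw [redE, traceRight_cqState]
  simp only [traceRight_sum, traceRight_smul, traceRight_kronecker, trace_basisProj, one_smul,
    traceRight_blockDiagonal]

theorem redE_cqState₀ (ρ : a → Matrix (Sys r s a bh bc) (Sys r s a bh bc) ℂ) :
    redE (G.cqState₀ ρ) = ∑ x, (G.pX x : ℂ) • ρ x := by
  simp only [redE, cqState₀, traceRight_sum, traceRight_smul, traceRight_kronecker,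
    trace_basisProj, one_smul]

theorem redY_cqState :
    redY (G.cqState ρ) = ∑ x, (G.pX x : ℂ) • traceLeft (blockDiagonal (ρ x)) := by
  simp only [redY, cqState, traceLeft_sum, traceLeft_smul, traceLeft_kronecker, trace_kronecker,
    trace_basisProj, mul_one, traceLeft_blockDiagonal, ← sum_smul_basisProj, Finset.smul_sum]

theorem redY_cqState₀ [Nonempty a] {ρ : a → Matrix (Sys r s a bh bc) (Sys r s a bh bc) ℂ}
    (h : ∀ x, (ρ x).trace = 1) : redY (G.cqState₀ ρ) = basisProj G.y0 := by
  simp only [redY, cqState₀, traceLeft_sum, traceLeft_smul, traceLeft_kronecker, trace_kronecker,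
    trace_basisProj, mul_one, h, one_smul]
  rw [← Finset.sum_smul, ← Complex.ofReal_sum, sum_pX, Complex.ofReal_one, one_smul]

theorem marginal_splitXY_cqState :
    marginal splitXY (G.cqState ρ)
      = ∑ x, (G.pX x : ℂ) • (traceLeft (blockDiagonal (ρ x)) ⊗ₖ basisProj x) := by
  ext ⟨k, x⟩ ⟨k', x'⟩
  simp only [marginal, splitXY, traceRight, of_apply, submatrix_apply, Equiv.coe_fn_symm_mk,
    traceLeft_blockDiagonal, ← sum_smul_basisProj, cqState, Matrix.sum_apply, Matrix.smul_apply,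
    kronecker_apply, smul_eq_mul, Matrix.trace, diag_apply, Finset.sum_mul, Finset.mul_sum]
  rw [Finset.sum_comm]
  refine Finset.sum_congr rfl fun x _ => ?_
  rw [Finset.sum_comm]
  exact Finset.sum_congr rfl fun _ _ => Finset.sum_congr rfl fun _ _ => by ring

theorem traceLeft_cq {ι ξ : Type*} [Fintype ι] [DecidableEq ι] [Fintype ξ] [DecidableEq ξ]
    (p : ξ → ℝ) {ρ : ξ → Matrix ι ι ℂ} (h : ∀ x, (ρ x).trace = 1) :
    traceLeft (∑ x, (p x : ℂ) • (ρ x ⊗ₖ basisProj x)) = diagonal fun x => (p x : ℂ) := by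
  simp only [traceLeft_sum, traceLeft_smul, traceLeft_kronecker, h, one_smul, sum_smul_basisProj]

theorem condEntropy_cq {ι ξ : Type*} [Fintype ι] [DecidableEq ι] [Fintype ξ] [DecidableEq ξ]
    (p : ξ → ℝ) {ρ : ξ → Matrix ι ι ℂ} (h : ∀ x, IsState (ρ x)) :
    condEntropy (∑ x, (p x : ℂ) • (ρ x ⊗ₖ basisProj x)) = ∑ x, p x * entropy (ρ x) := by
  rw [condEntropy, entropy_cq (fun x => (h x).isHermitian) (fun x => (h x).trace_eq),
    traceLeft_cq p fun x => (h x).trace_eq, entropy_diagonal]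
  ring

/-- Decoding and reset preserve the weight of each syndrome, so the entropy can be read off the
final state, where it meets `H(Y|EX)`. -/
theorem entropyYgivenX_eq [Nonempty bh] [Nonempty bc] :
    G.entropyYgivenX = ∑ x, G.pX x * entropy (traceLeft (blockDiagonal (G.σf x))) := by
  rw [entropyYgivenX, state2, marginal_splitXY_cqState,
    condEntropy_cq _ fun x => (G.isState_σ2 x).traceLeft]
  simp only [traceLeft_σf]

theorem bijective_splitYEX {E : Type*} :
    Function.Bijective (splitYEX : y × (E × a) → (E × a) × y) := (Equiv.prodComm _ _).bijective

theorem bijective_splitXE {E : Type*} : Function.Bijective (splitXE : a × E → E × a) :=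
  (Equiv.prodComm _ _).bijective

theorem entropyYgivenEX_eq [Nonempty bh] [Nonempty bc] :
    G.entropyYgivenEX = entropy G.stateF - entropy (traceRight G.stateF) := by
  rw [entropyYgivenEX, condEntropy,
    entropy_submatrix (ρ := G.stateF) (G.entropy_cqState G.isState_σf).1 bijective_splitYEX]
  rfl

/-- As `X` is classical, ordinary subadditivity for each `x` suffices; strong subadditivity is not
needed. -/
theorem entropyYgivenEX_le [Nonempty bh] [Nonempty bc] :
    G.entropyYgivenEX ≤ G.entropyYgivenX := by
  rw [entropyYgivenEX_eq, stateF, (G.entropy_cqState G.isState_σf).2, traceRight_cqState,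
    entropy_cq (fun x => (G.isState_σf x).traceRight.isHermitian)
      (fun x => (G.isState_σf x).traceRight.trace_eq), entropyYgivenX_eq,
    add_sub_add_left_eq_sub, ← Finset.sum_sub_distrib]
  refine Finset.sum_le_sum fun x _ => ?_
  rw [← mul_sub]
  have := entropy_le_add (G.isState_σf x).posSemidef (G.isState_σf x).trace_eq
  exact mul_le_mul_of_nonneg_left (by linarith) (G.pX_nonneg x)

theorem entropyXgivenE_eq [Nonempty bh] [Nonempty bc] :
    G.entropyXgivenE = entropy (traceRight G.stateF) - entropy (redE G.stateF) := by
  have h : (traceRight G.stateF).IsHermitian := by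
    rw [stateF, traceRight_cqState]
    exact isHermitian_cq G.pX_nonneg fun x => (G.isState_σf x).traceRight
  rw [entropyXgivenE, condEntropy, entropy_submatrix h bijective_splitXE]
  rfl

/-- The entropy of the whole engine at the end of the cycle. -/
theorem entropy_stateF_ge [Nonempty a] [Nonempty bh] [Nonempty bc] :
    entropy G.τA + entropy G.τh + entropy G.τc
        + ∑ x, G.pX x * (-log (G.instrumentEfficacy x)) ≤ entropy G.stateF := by
  -- `τA` is diagonal with entries `pX`, so its entropy is the Shannon entropy of `X`.
  rw [stateF, (G.entropy_cqState G.isState_σf).2, τA_eq, entropy_diagonal, add_assoc, add_assoc]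
  refine add_le_add le_rfl ?_
  calc _ = ∑ x, G.pX x * (entropy G.τh + entropy G.τc - log (G.instrumentEfficacy x)) := by
        simp only [mul_sub, mul_neg, Finset.sum_sub_distrib, Finset.sum_neg_distrib,
          ← Finset.sum_mul, sum_pX]
        ring
    _ ≤ _ := Finset.sum_le_sum fun x _ => mul_le_mul_of_nonneg_left
        (by rw [entropy_σf]; exact G.entropy_gain x) (G.pX_nonneg x)

end Registers

end Engine

namespace Engine

variable {r s a bh bc m y : Type*}
  [Fintype r] [DecidableEq r] [Fintype s] [DecidableEq s] [Fintype a] [DecidableEq a]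
  [Fintype bh] [DecidableEq bh] [Fintype bc] [DecidableEq bc] [Fintype m] [DecidableEq m]
  [Fintype y] [DecidableEq y]

variable (G : Engine r s a bh bc m y)

/-! ### Reduced states under different groupings of the subsystems -/

section Marginals

variable (ρ : Matrix (Sys r s a bh bc) (Sys r s a bh bc) ℂ)

/-- This and the following identities regroup one iterated partial trace. They exhibit each local
state either inside the spectator of an interaction, where it is unchanged, or inside the
interacting pair, where energy is conserved. -/
theorem traceLeft_eq_spectator_SA :
    traceLeft ρ = traceLeft (spectator splitSA ρ) := by
  ext i j
  simp only [traceLeft, spectator, of_apply, submatrix_apply]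
  rw [← Fintype.sum_prod_type']
  exact Fintype.sum_equiv (⟨fun q => ((q.1.1.1, q.2), (q.1.1.2, q.1.2)),
    fun q => (((q.1.1, q.2.1), q.2.2), q.1.2), fun _ => rfl, fun _ => rfl⟩ :
      ((r × s) × a) × bh ≃ (r × bh) × (s × a)) _ _ fun _ => rfl

theorem traceLeft_eq_spectator_SAh :
    traceLeft ρ = traceLeft (spectator splitSAh ρ) := by
  ext i j
  simp only [traceLeft, spectator, of_apply, submatrix_apply]
  rw [← Fintype.sum_prod_type']
  exact Fintype.sum_equiv (⟨fun q => (q.1.1.1, ((q.1.1.2, q.1.2), q.2)),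
    fun q => (((q.1, q.2.1.1), q.2.1.2), q.2.2), fun _ => rfl, fun _ => rfl⟩ :
      ((r × s) × a) × bh ≃ r × ((s × a) × bh)) _ _ fun _ => rfl

theorem traceLeft_eq_marginal_Ac :
    traceLeft ρ = traceLeft (marginal splitAc ρ) := by
  ext i j
  simp only [traceLeft, marginal, traceRight, of_apply, submatrix_apply]
  rw [← Fintype.sum_prod_type']
  exact Fintype.sum_equiv (⟨fun q => (q.1.2, (q.1.1, q.2)),
    fun q => ((q.2.1, q.1), q.2.2), fun _ => rfl, fun _ => rfl⟩ :
      ((r × s) × a) × bh ≃ a × ((r × s) × bh)) _ _ fun _ => rfl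

theorem hot_eq_spectator_SA :
    traceLeft (traceRight ρ) = traceLeft (traceRight (spectator splitSA ρ)) := by
  ext i j
  simp only [traceLeft, traceRight, spectator, of_apply, submatrix_apply]
  rw [← Fintype.sum_prod_type', ← Fintype.sum_prod_type', ← Fintype.sum_prod_type']
  exact Fintype.sum_equiv (⟨fun q => ((q.1.1.1, q.2), (q.1.1.2, q.1.2)),
    fun q => (((q.1.1, q.2.1), q.2.2), q.1.2), fun _ => rfl, fun _ => rfl⟩ :
      ((r × s) × a) × bc ≃ (r × bc) × (s × a)) _ _ fun _ => rfl

theorem hot_eq_spectator_Ac :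
    traceLeft (traceRight ρ) = traceLeft (spectator splitAc ρ) := by
  ext i j
  simp only [traceLeft, traceRight, spectator, of_apply, submatrix_apply]
  rw [← Fintype.sum_prod_type', ← Fintype.sum_prod_type']
  exact Fintype.sum_equiv (⟨fun q => (q.1.1, (q.1.2, q.2)),
    fun q => ((q.1, q.2.1), q.2.2), fun _ => rfl, fun _ => rfl⟩ :
      ((r × s) × a) × bc ≃ (r × s) × (a × bc)) _ _ fun _ => rfl

theorem hot_eq_marginal_SAh :
    traceLeft (traceRight ρ) = traceLeft (marginal splitSAh ρ) := by
  ext i j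
  simp only [traceLeft, traceRight, marginal, of_apply, submatrix_apply]
  rw [← Fintype.sum_prod_type', ← Fintype.sum_prod_type']
  exact Fintype.sum_equiv (⟨fun q => ((q.1.1.2, q.1.2), (q.1.1.1, q.2)),
    fun q => (((q.2.1, q.1.1), q.1.2), q.2.2), fun _ => rfl, fun _ => rfl⟩ :
      ((r × s) × a) × bc ≃ (s × a) × (r × bc)) _ _ fun _ => rfl

theorem marginal_SA_eq_marginal_SAh :
    marginal splitSA ρ = traceRight (marginal splitSAh ρ) := by
  ext i j
  simp only [traceRight, marginal, of_apply, submatrix_apply]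
  rw [← Fintype.sum_prod_type']
  exact Fintype.sum_equiv (⟨fun q => (q.1.2, (q.1.1, q.2)),
    fun q => ((q.2.1, q.1), q.2.2), fun _ => rfl, fun _ => rfl⟩ :
      (r × bh) × bc ≃ bh × (r × bc)) _ _ fun _ => rfl

theorem traceRight_marginal_SA :
    traceRight (marginal splitSA ρ) = traceLeft (traceRight (spectator splitAc ρ)) := by
  ext i j
  simp only [traceRight, traceLeft, spectator, marginal, of_apply, submatrix_apply]
  rw [← Fintype.sum_prod_type', ← Fintype.sum_prod_type', ← Fintype.sum_prod_type']
  exact Fintype.sum_equiv (⟨fun q => ((q.2.1.1, q.2.1.2), (q.1, q.2.2)),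
    fun q => (q.2.1, ((q.1.1, q.1.2), q.2.2)), fun _ => rfl, fun _ => rfl⟩ :
      a × ((r × bh) × bc) ≃ (r × bh) × (a × bc)) _ _ fun _ => rfl

theorem traceLeft_marginal_SA :
    traceLeft (marginal splitSA ρ) = traceRight (marginal splitAc ρ) := by
  ext i j
  simp only [traceRight, traceLeft, marginal, of_apply, submatrix_apply]
  rw [← Fintype.sum_prod_type', ← Fintype.sum_prod_type']
  exact Fintype.sum_equiv (⟨fun q => (q.2.2, ((q.2.1.1, q.1), q.2.1.2)),
    fun q => (q.2.1.2, ((q.2.1.1, q.2.2), q.1)), fun _ => rfl, fun _ => rfl⟩ :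
      s × ((r × bh) × bc) ≃ bc × ((r × s) × bh)) _ _ fun _ => rfl

theorem traceLeft_redRSA : traceLeft (redRSA ρ) = traceRight (marginal splitAc ρ) := by
  ext i j
  simp only [redRSA, traceRight, traceLeft, marginal, of_apply, submatrix_apply]
  rw [← Fintype.sum_prod_type', ← Fintype.sum_prod_type', ← Fintype.sum_prod_type']
  exact Fintype.sum_equiv (⟨fun q => (q.2, (q.1.1, q.1.2)),
    fun q => ((q.2.1, q.2.2), q.1), fun _ => rfl, fun _ => rfl⟩ :
      ((r × s) × bh) × bc ≃ bc × ((r × s) × bh)) _ _ fun _ => rfl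

end Marginals

theorem isState_redE_stateF [Nonempty a] [Nonempty bh] [Nonempty bc] :
    IsState (redE G.stateF) := by
  rw [stateF, redE_cqState]
  refine IsState.sum_smul G.pX_nonneg G.sum_pX fun x => ?_
  rw [← traceRight_blockDiagonal]
  exact (G.isState_σf x).traceRight

/-- `τA` is diagonal in the measured basis, so forgetting the outcome undoes the initial
measurement, which therefore costs no energy. -/
theorem redE_state0 : redE G.state0 = ((pureState G.ψ ⊗ₖ G.τA) ⊗ₖ G.τh) ⊗ₖ G.τc := by
  rw [state0, redE_cqState₀, τA_eq, ← sum_smul_basisProj]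
  ext ⟨⟨⟨i, j⟩, k⟩, l⟩ ⟨⟨⟨i', j'⟩, k'⟩, l'⟩
  simp only [σ0, Matrix.sum_apply, Matrix.smul_apply, kronecker_apply, smul_eq_mul,
    Finset.mul_sum, Finset.sum_mul]
  exact Finset.sum_congr rfl fun _ _ => by ring

theorem redE_stateI : redE G.stateI = ((pureState G.ψ ⊗ₖ G.τA) ⊗ₖ G.τh) ⊗ₖ G.τc := by
  rw [stateI, redE, traceRight_kronecker, trace_basisProj, one_smul, traceRight_kronecker,
    trace_basisProj, one_smul]

theorem redE_stateEnc_spectator :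
    spectator splitSA (redE G.stateEnc) = spectator splitSA (redE G.state0) := by
  simp only [stateEnc, state0, redE_cqState₀, spectator_sum, spectator_smul, σenc,
    spectator_evolve]

theorem redE_state1 : redE G.state1 = evolve splitSAh G.Uh (redE G.stateEnc) := by
  simp only [state1, stateEnc, redE_cqState₀, evolve_sum_smul, σ1]

theorem redE_state3_spectator :
    spectator splitSA (redE G.state3) = spectator splitSA (redE G.state1) := by
  simp only [state3, state1, redE_cqState, redE_cqState₀, spectator_sum, spectator_smul, σ3,
    spectator_evolve]
  refine Finset.sum_congr rfl fun x _ => ?_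
  congr 1
  exact (G.N_instrument x).sum_traceLeft _

theorem redE_stateF : redE G.stateF = evolve splitAc G.Uc (redE G.state3) := by
  rw [stateF, state3, redE_cqState, redE_cqState, evolve_sum_smul]
  simp only [evolve_sum, σf]

theorem redBh_stateI [Nonempty a] [Nonempty bc] : redBh G.stateI = G.τh := by
  rw [redBh, redE_stateI, traceRight_kronecker, G.isState_τc.trace_eq, one_smul,
    traceLeft_kronecker, ((isState_pureState G.ψ_unit).kronecker G.isState_τA).trace_eq, one_smul]

theorem redBc_stateI [Nonempty a] [Nonempty bh] : redBc G.stateI = G.τc := by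
  rw [redBc, redE_stateI, traceLeft_kronecker,
    (((isState_pureState G.ψ_unit).kronecker G.isState_τA).kronecker G.isState_τh).trace_eq,
    one_smul]

theorem redBh_stateEnc : redBh G.stateEnc = redBh G.stateI := by
  rw [redBh, redBh, hot_eq_spectator_SA, redE_stateEnc_spectator, ← hot_eq_spectator_SA,
    redE_state0, redE_stateI]

theorem redBh_stateF : redBh G.stateF = redBh G.state1 := by
  rw [redBh, redBh, hot_eq_spectator_Ac, redE_stateF, spectator_evolve, ← hot_eq_spectator_Ac,
    hot_eq_spectator_SA, redE_state3_spectator, ← hot_eq_spectator_SA]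

theorem redBc_state3 : redBc G.state3 = redBc G.stateI := by
  rw [redBc, redBc, traceLeft_eq_spectator_SA, redE_state3_spectator, ← traceLeft_eq_spectator_SA,
    traceLeft_eq_spectator_SAh, redE_state1, spectator_evolve, ← traceLeft_eq_spectator_SAh,
    traceLeft_eq_spectator_SA, redE_stateEnc_spectator, ← traceLeft_eq_spectator_SA,
    redE_state0, redE_stateI]

/-- Energy balance of the thermal noise. -/
theorem heatHot_eq :
    G.heatHot = expect (redSA G.state1) G.Henc - expect (redSA G.stateEnc) G.Henc := by
  have h := expect_conserved G.Uh_comm (marginal splitSAh (redE G.stateEnc))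
  rw [← marginal_evolve, ← redE_state1, expect_add_local, expect_add_local,
    ← marginal_SA_eq_marginal_SAh, ← marginal_SA_eq_marginal_SAh, ← hot_eq_marginal_SAh,
    ← hot_eq_marginal_SAh] at h
  rw [heatHot, redBh_stateF, ← redBh_stateEnc]
  simp only [redSA, redBh] at h ⊢
  linarith

/-- Energy balance of the reset. -/
theorem heatCold_eq :
    G.heatCold = expect (redSA G.stateF) G.Hinit - expect (redSA G.state3) G.Hinit := by
  have h := expect_conserved G.Uc_comm (marginal splitAc (redE G.state3))
  rw [← marginal_evolve, ← redE_stateF, expect_add_local, expect_add_local,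
    ← traceLeft_marginal_SA, ← traceLeft_marginal_SA, ← traceLeft_eq_marginal_Ac,
    ← traceLeft_eq_marginal_Ac] at h
  -- The `S` part of `Hinit` lies outside `AB_c`, so its expectation is the same before and after
  -- the reset and cancels.
  rw [heatCold, ← redBc_state3, redSA, redSA, Hinit, expect_add_local, expect_add_local,
    traceRight_marginal_SA, traceRight_marginal_SA, redE_stateF, spectator_evolve, ← redE_stateF]
  simp only [redBc, HA] at h ⊢
  linarith

/-- `ρ` is a product of a state with the thermal state of the cold bath. -/
def ColdProduct (ρ : Matrix (Sys r s a bh bc) (Sys r s a bh bc) ℂ) : Prop :=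
  ∃ ω, ρ = ω ⊗ₖ G.τc

variable {G}

theorem ColdProduct.sum_smul {ξ : Type*} [Fintype ξ]
    {ρ : ξ → Matrix (Sys r s a bh bc) (Sys r s a bh bc) ℂ} (h : ∀ x, G.ColdProduct (ρ x))
    (p : ξ → ℂ) : G.ColdProduct (∑ x, p x • ρ x) := by
  choose ω hω using h
  refine ⟨∑ x, p x • ω x, ?_⟩
  ext ⟨i, j⟩ ⟨i', j'⟩
  simp only [hω, Matrix.sum_apply, Matrix.smul_apply, kronecker_apply, smul_eq_mul,
    Finset.sum_mul]
  exact Finset.sum_congr rfl fun _ _ => by ring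

/-- `he` says that the unitary's subsystem avoids `B_c`, so its lift is a tensor product with the
identity there. The product form must persist until the reset because `Uc_reset` speaks only of
inputs `ρ ⊗ τc`. -/
theorem ColdProduct.evolve {κ ν μ : Type*} [Fintype κ] [DecidableEq κ] [Fintype ν] [DecidableEq ν]
    [Fintype μ] [DecidableEq μ]
    {ρ : Matrix (Sys r s a bh bc) (Sys r s a bh bc) ℂ} (h : G.ColdProduct ρ)
    (e : Sys r s a bh bc ≃ κ × ν) (e' : ((r × s) × a) × bh ≃ κ × μ) (g : ν ≃ μ × bc)
    (he : ∀ q, e q = ((e' q.1).1, g.symm ((e' q.1).2, q.2))) (U : Matrix.unitaryGroup κ ℂ) :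
    G.ColdProduct (evolve e U ρ) := by
  obtain ⟨ω, rfl⟩ := h
  have hl : lift e (U : Matrix κ κ ℂ) = lift e' (U : Matrix κ κ ℂ) ⊗ₖ (1 : Matrix bc bc ℂ) := by
    ext ⟨i, j⟩ ⟨i', j'⟩
    simp only [lift, submatrix_apply, kronecker_apply, he, one_apply,
      EmbeddingLike.apply_eq_iff_eq, Prod.mk.injEq, mul_ite, mul_one, mul_zero]
    split_ifs <;> simp_all [one_apply]
  refine ⟨QECEngine.evolve e' U ω, ?_⟩
  rw [QECEngine.evolve, hl, conjTranspose_kronecker, ← mul_kronecker_mul, ← mul_kronecker_mul,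
    conjTranspose_one, Matrix.one_mul, Matrix.mul_one]
  rfl

theorem ColdProduct.evolve_SA {ρ : Matrix (Sys r s a bh bc) (Sys r s a bh bc) ℂ}
    (h : G.ColdProduct ρ) (U : Matrix.unitaryGroup (s × a) ℂ) :
    G.ColdProduct (QECEngine.evolve splitSA U ρ) :=
  h.evolve splitSA ⟨fun q => ((q.1.1.2, q.1.2), (q.1.1.1, q.2)),
    fun q => (((q.2.1, q.1.1), q.1.2), q.2.2), fun _ => rfl, fun _ => rfl⟩ (Equiv.refl _)
    (fun _ => rfl) U

variable (G)

theorem coldProduct_σ1 (x : a) : G.ColdProduct (G.σ1 x) :=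
  (ColdProduct.evolve_SA ⟨_, rfl⟩ (G.Uenc x)).evolve splitSAh
    ⟨fun q => (((q.1.1.2, q.1.2), q.2), q.1.1.1),
      fun q => (((q.2, q.1.1.1), q.1.1.2), q.1.2), fun _ => rfl, fun _ => rfl⟩ (Equiv.refl _)
    (fun _ => rfl) G.Uh

theorem coldProduct_σ3 (x : a) (k : y) : G.ColdProduct (G.σ3 x k) := by
  refine ColdProduct.evolve_SA ?_ _
  obtain ⟨ω, hω⟩ := G.coldProduct_σ1 x
  -- The witness applies the instrument branch to the remaining factor `ω`; each entry of `τc` is a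
  -- scalar that linearity pulls out of `N`.
  refine ⟨of fun p q => G.N x k
    (of fun l l' => ω (((p.1.1.1, l.1), l.2), p.2) (((q.1.1.1, l'.1), l'.2), q.2))
    (p.1.1.2, p.1.2) (q.1.1.2, q.1.2), ?_⟩
  ext ⟨⟨⟨⟨i₁, i₂⟩, i₃⟩, i₄⟩, i₅⟩ ⟨⟨⟨⟨j₁, j₂⟩, j₃⟩, j₄⟩, j₅⟩
  have e : (of fun l l' : s × a => G.σ1 x ((((i₁, l.1), l.2), i₄), i₅) ((((j₁, l'.1), l'.2), j₄), j₅))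
      = G.τc i₅ j₅ • of fun l l' : s × a => ω (((i₁, l.1), l.2), i₄) (((j₁, l'.1), l'.2), j₄) := by
    ext l l'
    simp [hω, mul_comm]
  have e2 := congrArg (fun M => G.N x k M (i₂, i₃) (j₂, j₃)) e
  simp only [map_smul, Matrix.smul_apply, smul_eq_mul] at e2
  rw [kronecker_apply, mul_comm]
  exact e2

/-- The reset returns the ancilla to its thermal state. -/
theorem traceRight_marginal_stateF [Nonempty a] [Nonempty bh] [Nonempty bc] :
    traceRight (marginal splitAc (redE G.stateF)) = G.τA := by
  have h3 : G.ColdProduct (redE G.state3) := by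
    rw [state3, redE_cqState]
    refine ColdProduct.sum_smul (fun x => ?_) _
    simpa using ColdProduct.sum_smul (fun k => G.coldProduct_σ3 x k) fun _ => 1
  obtain ⟨ω, hω⟩ := h3
  have hm : marginal splitAc (redE G.state3)
      = (of fun i j => ∑ q : (r × s) × bh, ω ((q.1, i), q.2) ((q.1, j), q.2)) ⊗ₖ G.τc := by
    ext ⟨i, j⟩ ⟨i', j'⟩
    simp [marginal, traceRight, splitAc, hω, Finset.sum_mul]
  -- The reset yields `τA` times the trace of the incoming marginal; comparing traces shows that
  -- this factor is 1.
  have ht : (traceRight (marginal splitAc (redE G.stateF))).trace = 1 :=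
    (G.isState_redE_stateF.marginal splitAc).traceRight.trace_eq
  have hr : traceRight (marginal splitAc (redE G.stateF))
      = (of fun i j => ∑ q : (r × s) × bh, ω ((q.1, i), q.2) ((q.1, j), q.2)).trace • G.τA := by
    rw [redE_stateF, marginal_evolve, hm]
    exact G.Uc_reset _
  rw [hr, trace_smul, G.isState_τA.trace_eq, smul_eq_mul, mul_one] at ht
  rw [hr, ht, one_smul]

theorem redY_stateI [Nonempty a] [Nonempty bh] [Nonempty bc] : redY G.stateI = basisProj G.y0 := by
  have h : IsState (((((pureState G.ψ ⊗ₖ G.τA) ⊗ₖ G.τh) ⊗ₖ G.τc) ⊗ₖ basisProj G.x0)) :=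
    ((((isState_pureState G.ψ_unit).kronecker G.isState_τA).kronecker G.isState_τh).kronecker
      G.isState_τc).kronecker (isState_basisProj _)
  rw [redY, stateI, traceLeft_kronecker, h.trace_eq, one_smul]

theorem redY_stateErase [Nonempty a] [Nonempty bh] [Nonempty bc] :
    redY G.stateErase = basisProj G.y0 := by
  rw [redY, stateErase, traceLeft_kronecker,
    (G.isState_redE_stateF.kronecker (isState_basisProj _)).trace_eq, one_smul]

theorem redE_stateErase : redE G.stateErase = redE G.stateF := by
  rw [stateErase, redE, traceRight_kronecker, trace_basisProj, one_smul, traceRight_kronecker,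
    trace_basisProj, one_smul]

theorem redY_state0 [Nonempty a] [Nonempty bh] [Nonempty bc] :
    redY G.state0 = basisProj G.y0 := G.redY_cqState₀ fun x => (G.isState_σ0 x).trace_eq

theorem redY_stateEnc [Nonempty a] [Nonempty bh] [Nonempty bc] :
    redY G.stateEnc = basisProj G.y0 := G.redY_cqState₀ fun x => (G.isState_σenc x).trace_eq

theorem redY_state1 [Nonempty a] [Nonempty bh] [Nonempty bc] :
    redY G.state1 = basisProj G.y0 := G.redY_cqState₀ fun x => (G.isState_σ1 x).trace_eq

theorem redY_state3 : redY G.state3 = redY G.stateF := by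
  rw [state3, stateF, redY_cqState, redY_cqState]
  simp only [traceLeft_blockDiagonal, trace_σ3, trace_σf]

/-- The first law over the cycle. -/
theorem deltaU_eq [Nonempty a] [Nonempty bh] [Nonempty bc] :
    G.deltaU = G.workTot + G.heatHot + G.heatMeas + G.heatCold + G.heatErase := by
  -- The energies of `SA` telescope. Those of `Y` cancel too: `Y` starts and ends in `y0`, and what
  -- it gains in the measurement is given up in the erasure.
  rw [heatHot_eq, heatCold_eq, workTot, workEnc, workMeas, workDec, deltaU, heatErase]
  simp only [internalEnergy, redY_stateI, redY_stateErase, redY_state0, redY_stateEnc,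
    redY_state1, redY_state3, redSA, redE_stateErase, redE_stateI, redE_state0]
  ring

/-- `Y` starts in a ground state, so its energy cannot fall. This resolves the absolute value in the
Landauer assumption. -/
theorem heatErase_nonpos [Nonempty a] [Nonempty bh] [Nonempty bc] : G.heatErase ≤ 0 := by
  have hY : IsState (redY G.stateF) := by
    rw [stateF, redY_cqState]
    exact IsState.sum_smul G.pX_nonneg G.sum_pX fun x => (G.isState_σf x).traceLeft
  obtain ⟨U, d, h⟩ := exists_diagonalizes hY.isHermitian
  have hd := h.nonneg hY.posSemidef
  have h1 : 0 ≤ (redY G.stateF * (G.HY - G.HY G.y0 G.y0 • (1 : Matrix y y ℂ))).trace.re := by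
    rw [h.trace_mul_re]
    exact Finset.sum_nonneg fun i _ => mul_nonneg (hd i)
      (re_diag_nonneg (G.ground.conjTranspose_mul_mul_same U) i)
  rw [Matrix.mul_sub, trace_sub, Matrix.mul_smul, Matrix.mul_one, trace_smul, hY.trace_eq,
    smul_eq_mul, mul_one, Complex.sub_re] at h1
  have h2 : expect (basisProj G.y0) G.HY = (G.HY G.y0 G.y0).re := by
    simp [expect, basisProj, Matrix.trace_single_mul]
  rw [heatErase, redY_stateI, h2, expect]
  linarith

end Engine

/-! ### Chain rules for the measurement heats -/

section ChainRules

variable {Q m y x : Type*} [Fintype Q] [DecidableEq Q] [Fintype m] [DecidableEq m]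
  [Fintype y] [DecidableEq y] [Fintype x] [DecidableEq x]

open Engine

theorem bijective_splitQMYX :
    Function.Bijective (splitQMYX : (Q × m) × (y × x) → ((Q × m) × y) × x) :=
  (Equiv.prodAssoc _ _ _).symm.bijective

theorem bijective_prodAssoc_symm :
    Function.Bijective (fun q : Q × (m × x) => ((q.1, q.2.1), q.2.2)) :=
  (Equiv.prodAssoc Q m x).symm.bijective

/-- Reduced state on the apparatus and the register `X`. -/
noncomputable def redMX (ρ : Matrix (((Q × m) × y) × x) (((Q × m) × y) × x) ℂ) :
    Matrix (m × x) (m × x) ℂ :=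
  traceLeft ((marginal splitYMX ρ).submatrix
    (fun q : y × (m × x) => ((q.1, q.2.1), q.2.2)) (fun q : y × (m × x) => ((q.1, q.2.1), q.2.2)))

variable (ρ : Matrix (((Q × m) × y) × x) (((Q × m) × y) × x) ℂ)

theorem traceRight_redMX : traceRight (redMX ρ) = traceLeft (traceRight (traceRight ρ)) := by
  ext i j
  simp only [redMX, traceLeft, traceRight, marginal, of_apply, submatrix_apply]
  rw [← Fintype.sum_prod_type', ← Fintype.sum_prod_type', ← Fintype.sum_prod_type',
    ← Fintype.sum_prod_type']
  exact Fintype.sum_equiv (⟨fun q => ((q.2, q.1.2), q.1.1), fun q => ((q.2, q.1.2), q.1.1),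
    fun _ => rfl, fun _ => rfl⟩ : (x × y) × Q ≃ (Q × y) × x) _ _ fun _ => rfl

theorem traceLeft_redMX : traceLeft (redMX ρ) = traceLeft ρ := by
  ext i j
  simp only [redMX, traceLeft, traceRight, marginal, of_apply, submatrix_apply]
  rw [← Fintype.sum_prod_type', ← Fintype.sum_prod_type']
  exact Fintype.sum_equiv (⟨fun q => ((q.2, q.1.1), q.1.2), fun q => ((q.1.2, q.2), q.1.1),
    fun _ => rfl, fun _ => rfl⟩ : (m × y) × Q ≃ (Q × m) × y) _ _ fun _ => rfl

theorem traceLeft_marginal_YX : traceLeft (marginal splitYX ρ) = traceLeft ρ := by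
  ext i j
  simp only [traceLeft, traceRight, marginal, of_apply, submatrix_apply]
  rw [← Fintype.sum_prod_type']
  exact Fintype.sum_equiv (Equiv.prodComm _ _) _ _ fun _ => rfl

theorem traceLeft_marginal_QYX : traceLeft (marginal splitQYX ρ) = marginal splitYX ρ := by
  ext i j
  simp only [traceLeft, traceRight, marginal, of_apply, submatrix_apply]
  rw [← Fintype.sum_prod_type']
  rfl

theorem traceRight_marginal_YMX :
    traceRight ((marginal splitYMX ρ).submatrix
      (fun q : (y × x) × m => ((q.1.1, q.2), q.1.2)) (fun q : (y × x) × m => ((q.1.1, q.2), q.1.2)))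
      = marginal splitYX ρ := by
  ext i j
  simp only [traceRight, marginal, of_apply, submatrix_apply]
  rw [← Fintype.sum_prod_type']
  exact Fintype.sum_equiv (Equiv.prodComm _ _) _ _ fun _ => rfl

variable {ρ}

theorem isState_redMX (hρ : IsState ρ) : IsState (redMX ρ) :=
  ((hρ.marginal splitYMX).submatrix bijective_prodAssoc_symm).traceLeft

/-- The left side is `H(Y|MX)`. Its companion below is `H(RSA|MYX)`, so the two add up to the
entropy of everything minus that of `MX`. -/
theorem condEntropy_sub_condMutualInfo_YMX (hρ : IsState ρ) :
    condEntropy (marginal splitYX ρ) - condMutualInfo (marginal splitYMX ρ)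
      = entropy (marginal splitYMX ρ) - entropy (redMX ρ) := by
  rw [condMutualInfo, traceRight_marginal_YMX, sub_sub_cancel, condEntropy,
    entropy_submatrix (hρ.marginal splitYMX).isHermitian bijective_prodAssoc_symm]
  rfl

theorem condEntropy_sub_condMutualInfo_QMYX (hρ : IsState ρ) :
    condEntropy (marginal splitQYX ρ) - condMutualInfo (ρ.submatrix splitQMYX splitQMYX)
      = entropy ρ - entropy (marginal splitYMX ρ) := by
  have h1 : traceRight ((ρ.submatrix splitQMYX splitQMYX).submatrix
      (fun q : (Q × (y × x)) × m => ((q.1.1, q.2), q.1.2))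
      (fun q : (Q × (y × x)) × m => ((q.1.1, q.2), q.1.2))) = marginal splitQYX ρ := rfl
  have hb : Function.Bijective (fun q : m × (y × x) => ((q.2.1, q.1), q.2.2)) :=
    (⟨_, fun q => (q.1.2, (q.1.1, q.2)), fun _ => rfl, fun _ => rfl⟩ :
      m × (y × x) ≃ (y × m) × x).bijective
  have h2 : traceLeft ((ρ.submatrix splitQMYX splitQMYX).submatrix
      (fun q : Q × (m × (y × x)) => ((q.1, q.2.1), q.2.2))
      (fun q : Q × (m × (y × x)) => ((q.1, q.2.1), q.2.2)))
      = (marginal splitYMX ρ).submatrix (fun q : m × (y × x) => ((q.2.1, q.1), q.2.2))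
          (fun q : m × (y × x) => ((q.2.1, q.1), q.2.2)) := rfl
  rw [condMutualInfo, h1, sub_sub_cancel, condEntropy,
    h2, entropy_submatrix (hρ.submatrix bijective_splitQMYX).isHermitian bijective_prodAssoc_symm,
    entropy_submatrix hρ.isHermitian bijective_splitQMYX,
    entropy_submatrix (hρ.marginal splitYMX).isHermitian hb]

theorem condEntropy_YX_add_condEntropy_QYX :
    condEntropy (marginal splitYX ρ) + condEntropy (marginal splitQYX ρ)
      = entropy (marginal splitQYX ρ) - entropy (traceLeft ρ) := by
  rw [condEntropy, condEntropy, traceLeft_marginal_QYX, traceLeft_marginal_YX]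
  ring

end ChainRules

/-! ### Second laws for the apparatus and for the engine -/

namespace Engine

variable {r s a bh bc m y : Type*}
  [Fintype r] [DecidableEq r] [Fintype s] [DecidableEq s] [Fintype a] [DecidableEq a]
  [Fintype bh] [DecidableEq bh] [Fintype bc] [DecidableEq bc] [Fintype m] [DecidableEq m]
  [Fintype y] [DecidableEq y]

variable (G : Engine r s a bh bc m y)

theorem isState_redRSA_σ1 [Nonempty bh] [Nonempty bc] (x : a) : IsState (redRSA (G.σ1 x)) :=
  (G.isState_σ1 x).traceRight.traceRight

theorem isState_preMeas [Nonempty bh] [Nonempty bc] [Nonempty m] (x : a) :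
    IsState (G.preMeas x) :=
  ((G.isState_redRSA_σ1 x).kronecker G.isState_τM).kronecker (isState_basisProj _)

theorem entropy_preMeas [Nonempty bh] [Nonempty bc] [Nonempty m] (x : a) :
    entropy (G.preMeas x) = entropy (redRSA (G.σ1 x)) + entropy G.τM := by
  rw [preMeas, ((G.isState_redRSA_σ1 x).kronecker G.isState_τM).entropy_kronecker
    (isState_basisProj _), (G.isState_redRSA_σ1 x).entropy_kronecker G.isState_τM,
    entropy_basisProj, add_zero]

theorem isState_cq {ι ξ : Type*} [Fintype ι] [DecidableEq ι] [Fintype ξ] [DecidableEq ξ]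
    {p : ξ → ℝ} (hp : ∀ x, 0 ≤ p x) (hp1 : ∑ x, p x = 1) {ρ : ξ → Matrix ι ι ℂ}
    (h : ∀ x, IsState (ρ x)) : IsState (∑ x, (p x : ℂ) • (ρ x ⊗ₖ basisProj x)) :=
  IsState.sum_smul hp hp1 fun x => (h x).kronecker (isState_basisProj x)

theorem isState_postMeasX [Nonempty a] [Nonempty bh] [Nonempty bc] [Nonempty m] :
    IsState G.postMeasX :=
  isState_cq G.pX_nonneg G.sum_pX fun x => (G.isState_preMeas x).evolve _ _

theorem entropy_postMeasX [Nonempty bh] [Nonempty bc] [Nonempty m] :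
    entropy G.postMeasX = ∑ x, negMulLog (G.pX x)
      + ∑ x, G.pX x * (entropy (redRSA (G.σ1 x)) + entropy G.τM) := by
  have h := fun x => (G.isState_preMeas x).evolve splitSAMY (G.Umeas x)
  rw [postMeasX, entropy_cq (fun x => (h x).isHermitian) fun x => (h x).trace_eq]
  simp only [entropy_evolve (G.isState_preMeas _), entropy_preMeas]

theorem marginal_splitQYX_preMeasX [Nonempty m] :
    marginal splitQYX G.preMeasX
      = (∑ x, (G.pX x : ℂ) • ((redRSA (G.σ1 x) ⊗ₖ basisProj G.y0) ⊗ₖ basisProj x)).submatrix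
          (Equiv.prodAssoc _ _ _).symm (Equiv.prodAssoc _ _ _).symm := by
  ext ⟨i, k, x⟩ ⟨i', k', x'⟩
  have ht : ∑ l, G.τM l l = 1 := G.isState_τM.trace_eq
  simp only [marginal, splitQYX, traceRight, preMeasX, preMeas, of_apply, submatrix_apply,
    Matrix.sum_apply, Matrix.smul_apply, kronecker_apply, smul_eq_mul, Equiv.coe_fn_symm_mk,
    Equiv.prodAssoc_symm_apply]
  rw [Finset.sum_comm]
  refine Finset.sum_congr rfl fun x _ => ?_
  calc _ = (∑ l, G.τM l l) * ((G.pX x : ℂ) * (redRSA (G.σ1 x) i i' * basisProj G.y0 k k'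
          * basisProj x _ _)) := by
        rw [Finset.sum_mul]; exact Finset.sum_congr rfl fun _ _ => by ring
    _ = _ := by rw [ht, one_mul]

theorem entropy_marginal_splitQYX_preMeasX [Nonempty bh] [Nonempty bc] [Nonempty m] :
    entropy (marginal splitQYX G.preMeasX) = ∑ x, negMulLog (G.pX x)
      + ∑ x, G.pX x * entropy (redRSA (G.σ1 x)) := by
  have h := fun x => (G.isState_redRSA_σ1 x).kronecker (isState_basisProj G.y0)
  rw [marginal_splitQYX_preMeasX, entropy_submatrix (isHermitian_cq G.pX_nonneg h)
    (Equiv.bijective _), entropy_cq (fun x => (h x).isHermitian) fun x => (h x).trace_eq]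
  simp only [(G.isState_redRSA_σ1 _).entropy_kronecker (isState_basisProj G.y0),
    entropy_basisProj, add_zero]

theorem redM_preMeasX [Nonempty a] [Nonempty bh] [Nonempty bc] [Nonempty m] :
    redM G.preMeasX = G.τM := by
  have hp : (∑ x, (G.pX x : ℂ)) = 1 := by
    rw [← Complex.ofReal_sum, sum_pX, Complex.ofReal_one]
  simp only [redM, preMeasX, traceRight_sum, traceRight_smul, traceRight_kronecker,
    trace_basisProj, one_smul, preMeas, traceLeft_sum, traceLeft_smul, traceLeft_kronecker,
    (G.isState_redRSA_σ1 _).trace_eq]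
  rw [← Finset.sum_smul, hp, one_smul]

/-- The second law for the measurement apparatus. -/
theorem heatMeas_le [Nonempty a] [Nonempty bh] [Nonempty bc] [Nonempty m] :
    G.heatMeas ≤ G.heatMeasY + G.heatMeasRSA := by
  have hS := G.isState_postMeasX
  have hM : IsState (redM G.postMeasX) := hS.traceRight.traceRight.traceLeft
  have hkT : 0 < G.kB * G.Tm := mul_pos G.kB_pos G.Tm_pos
  -- The apparatus starts thermal, so the energy it loses is at most `kB * Tm` times the entropy it
  -- loses.
  have hgibbs := entropy_sub_entropy_gibbs_le (1 / (G.kB * G.Tm)) G.HM_herm hM.posSemidef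
    hM.trace_eq
  have h1 : G.heatMeas ≤ G.kB * G.Tm * (entropy G.τM - entropy (redM G.postMeasX)) := by
    rw [heatMeas, redM_preMeasX]
    have h2 := mul_le_mul_of_nonneg_left hgibbs hkT.le
    rw [← mul_assoc, mul_one_div, div_self hkT.ne', one_mul] at h2
    simp only [τM]
    linarith
  refine h1.trans ?_
  rw [heatMeasY, heatMeasRSA, ← mul_add]
  refine mul_le_mul_of_nonneg_left ?_ hkT.le
  -- The two heats sum to `kB * Tm` times `[H(RSAMYX) - H(MX)]` after the measurement minus
  -- `[H(RSAYX) - H(X)]` before it. The total entropy is conserved and the initial apparatus is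
  -- uncorrelated, which leaves `H(τM) + H(X) - H(MX)`; subadditivity on `MX` concludes.
  have e1 := condEntropy_sub_condMutualInfo_YMX hS
  have e2 := condEntropy_sub_condMutualInfo_QMYX hS
  have e3 := condEntropy_YX_add_condEntropy_QYX (ρ := G.preMeasX)
  have e4 := entropy_le_add (isState_redMX hS).posSemidef (isState_redMX hS).trace_eq
  have ex : traceLeft G.postMeasX = traceLeft G.preMeasX := by
    rw [postMeasX, preMeasX, traceLeft_cq _ fun x => (G.isState_preMeas x).trace_eq,
      traceLeft_cq _ fun x => ((G.isState_preMeas x).evolve _ _).trace_eq]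
  rw [traceRight_redMX, traceLeft_redMX, ex] at e4
  have e5 := G.entropy_postMeasX
  simp only [mul_add, Finset.sum_add_distrib, ← Finset.sum_mul, sum_pX, one_mul] at e5
  have e6 := G.entropy_marginal_splitQYX_preMeasX
  simp only [redM]
  linarith

/-- The second law for the engine: the entropy produced by the baths is bounded by the entropy
exchange. -/
theorem entropyExchange_ge [Nonempty a] [Nonempty bh] [Nonempty bc] :
    G.heatHot / (G.kB * G.Th) + G.heatCold / (G.kB * G.Tc)
        + ∑ x, G.pX x * (-log (G.instrumentEfficacy x))
        - (G.entropyXgivenE + G.entropyYgivenEX) ≤ G.entropyExchange := by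
  have hE := G.isState_redE_stateF
  have hh : IsState (redBh G.stateF) := hE.traceRight.traceLeft
  have hc : IsState (redBc G.stateF) := hE.traceLeft
  have s1 := entropy_le_add hE.posSemidef hE.trace_eq
  have s2 := entropy_le_add hE.traceRight.posSemidef hE.traceRight.trace_eq
  have s3 := entropy_le_add hE.traceRight.traceRight.posSemidef hE.traceRight.traceRight.trace_eq
  -- The final entropy of `A` thus equals the entropy of `X` in `entropy_stateF_ge`, and the two
  -- cancel.
  have hA : traceLeft (traceRight (traceRight (redE G.stateF))) = G.τA :=
    (traceLeft_redRSA _).trans G.traceRight_marginal_stateF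
  rw [hA] at s3
  have g1 := entropy_sub_entropy_gibbs_le (1 / (G.kB * G.Th)) G.Hh_herm hh.posSemidef hh.trace_eq
  have g2 := entropy_sub_entropy_gibbs_le (1 / (G.kB * G.Tc)) G.Hc_herm hc.posSemidef hc.trace_eq
  have q1 : G.heatHot / (G.kB * G.Th) ≤ entropy G.τh - entropy (redBh G.stateF) := by
    rw [heatHot, redBh_stateI, div_eq_inv_mul, ← one_div]
    simp only [τh]
    linarith
  have q2 : G.heatCold / (G.kB * G.Tc) ≤ entropy G.τc - entropy (redBc G.stateF) := by
    rw [heatCold, redBc_stateI, div_eq_inv_mul, ← one_div]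
    simp only [τc]
    linarith
  have e1 := G.entropy_stateF_ge
  rw [entropyXgivenE_eq, entropyYgivenEX_eq]
  simp only [entropyExchange, redRS, redRSA, redBh, redBc] at *
  linarith

end Engine

end QECEngine

/-! ### The efficiency bound -/

theorem mainTheorem5 {r s a bh bc m y : Type*}
    [Fintype r] [DecidableEq r] [Fintype s] [DecidableEq s]
    [Fintype a] [DecidableEq a] [Nonempty a]
    [Fintype bh] [DecidableEq bh] [Nonempty bh] [Fintype bc] [DecidableEq bc] [Nonempty bc]
    [Fintype m] [DecidableEq m] [Nonempty m] [Fintype y] [DecidableEq y]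
    (G : QECEngine.Engine r s a bh bc m y)
    (hinput : 0 < G.heatInput) (hmeas : G.heatMeasRSA ≤ 0)
    (ε₁ ε₂ ε₃ : ℝ) (hε₁ : 0 ≤ ε₁) (hε₂ : 0 ≤ ε₂) (hε₃ : 0 ≤ ε₃)
    (assumption1 : |G.deltaU| ≤ ε₁ * G.heatInput)
    (assumption2 : G.entropyXgivenE ≤ ε₂ * G.entropyYgivenEX)
    (assumption3 : |(|G.heatErase| - G.kB * G.Tc * G.entropyYgivenX)|
      ≤ ε₃ * (G.kB * G.Tc * G.entropyYgivenX))
    (assumption4 : G.Tc / G.Th * G.heatMeasY ≤ |G.heatMeasRSA|) :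
    G.heatInput / (G.kB * G.Th) * ((G.efficiency - G.carnot) / (1 - G.carnot))
        + ∑ x, G.pX x * (-Real.log (G.instrumentEfficacy x))
        - (ε₁ * (G.heatInput / (G.kB * G.Tc)) + (ε₂ + ε₃) * G.entropyYgivenX)
      ≤ G.entropyExchange := by
  have hk := G.kB_pos
  have hTc := G.Tc_pos
  have hTh := G.Th_pos
  have hkc : 0 < G.kB * G.Tc := mul_pos hk hTc
  have hS := G.entropyExchange_ge
  have hY := G.entropyYgivenEX_le
  have hX : G.entropyXgivenE ≤ ε₂ * G.entropyYgivenX :=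
    assumption2.trans (mul_le_mul_of_nonneg_left hY hε₂)
  have hU := (neg_le_abs G.deltaU).trans assumption1
  have hfirst := G.deltaU_eq
  have hM := G.heatMeas_le
  rw [abs_of_nonpos hmeas] at assumption4
  rw [abs_of_nonpos G.heatErase_nonpos] at assumption3
  have hL := neg_abs_le (-G.heatErase - G.kB * G.Tc * G.entropyYgivenX)
  -- Uses `1 - η_C = T_c / T_h` and `η Q_input = -W_tot`.
  have hη : G.heatInput / (G.kB * G.Th) * ((G.efficiency - G.carnot) / (1 - G.carnot))
      = G.heatInput / (G.kB * G.Th) - (G.heatInput + G.workTot) / (G.kB * G.Tc) := by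
    have h1 : G.heatInput ≠ 0 := hinput.ne'
    rw [QECEngine.Engine.efficiency, QECEngine.Engine.carnot]
    have h2 : 1 - (1 - G.Tc / G.Th) = G.Tc / G.Th := by ring
    rw [h2]
    field_simp
    ring
  -- The hot heat matches the hot bath's entropy term; the rest, from `Q_meas^Y`, is what the fourth
  -- assumption covers.
  have hQ : G.heatInput / (G.kB * G.Th) = G.heatHot / (G.kB * G.Th)
      + G.Tc / G.Th * G.heatMeasY / (G.kB * G.Tc) := by
    rw [QECEngine.Engine.heatInput]
    field_simp
  -- The first law solved for `heatCold`. Only one side of each two-sided assumption enters: `ΔU ≥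
  -- -ε₁ Q_input`, and erasure heat at least `(1 - ε₃) kT_c H(Y|X)`.
  have hkey : G.Tc / G.Th * G.heatMeasY - (G.heatInput + G.workTot) - ε₁ * G.heatInput
      ≤ G.heatCold - G.kB * G.Tc * G.entropyYgivenX
        + ε₃ * (G.kB * G.Tc * G.entropyYgivenX) := by
    rw [QECEngine.Engine.heatInput] at *
    linarith
  have hdiv := div_le_div_of_nonneg_right hkey hkc.le
  have hsplit1 : (G.Tc / G.Th * G.heatMeasY - (G.heatInput + G.workTot) - ε₁ * G.heatInput)
      / (G.kB * G.Tc) = G.Tc / G.Th * G.heatMeasY / (G.kB * G.Tc)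
        - (G.heatInput + G.workTot) / (G.kB * G.Tc) - ε₁ * (G.heatInput / (G.kB * G.Tc)) := by
    rw [sub_div, sub_div, mul_div_assoc ε₁]
  have hsplit2 : (G.heatCold - G.kB * G.Tc * G.entropyYgivenX
        + ε₃ * (G.kB * G.Tc * G.entropyYgivenX)) / (G.kB * G.Tc)
      = G.heatCold / (G.kB * G.Tc) - G.entropyYgivenX + ε₃ * G.entropyYgivenX := by
    field_simp
  rw [hsplit1, hsplit2] at hdiv
  -- After substitution, the Landauer term `H(Y|X)` absorbs `H(Y|EX)` from the second law, leaving
  -- only the `ε` corrections.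
  rw [hη, hQ]
  linarith
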